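/- Let $\mathsf a\in\mathbb R^{s\times s}$, $\mathsf b\in\mathbb R^s$ be the coefficients of an $s$-stage Runge--Kutta method, let $\mathbb 1=(1,\dots,1)^T$, and let $\mathsf S(z)=1+z\,\mathsf b^T(\mathrm{id}-z\mathsf a)^{-1}\mathbb 1$ be its stability function. Assume that (RK1) $|\mathsf S(z)|\le 1$ and (RK2) the matrix $\mathrm{id}-z\mathsf a$ is invertible, for all $z\in\mathbb C$ with $\operatorname{Re} z\le 0$. Let $\mathcal Y$ be a real or complex Hilbert space and let $A$ be a closed, densely defined linear operator on $\mathcal Y$ which generates a $C_0$-semigroup. For $k\in\mathbb N_0$ let $\mathcal Y_k=D(A^k)$, with $\mathcal Y_0=\mathcal Y$ and inner product $\langle U,V\rangle_{\mathcal Y_{k+1}}=\langle AU,AV\rangle_{\mathcal Y_k}+\langle U,V\rangle_{\mathcal Y_k}$. Assume that, for some $K\in\mathbb N_0$, (A2) $A=A_{\mathrm n}+A_{\mathrm b}$, where $A_{\mathrm n}$ is a (possibly unbounded) normal operator, i.e. densely defined and closed with $A_{\mathrm n}A_{\mathrm n}^*=A_{\mathrm n}^*A_{\mathrm n}$, and $A_{\mathrm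 b}$ is bounded as a linear operator on each of $\mathcal Y_0,\dots,\mathcal Y_K$. For $h\ge 0$ let $\mathsf S(hA)=\mathrm{id}+h\,\mathsf b^T A(\mathrm{id}-h\mathsf aA)^{-1}\mathbb 1$, i.e. $\mathsf S(hA)U=U+h\sum_{j}\mathsf b_jAW^j$, where $W\in D(A)^s$ solves $W^i-h\sum_j\mathsf a_{ij}AW^j=U$ for $i=1,\dots,s$; where the set of $U$ for which such a $W$ exists is not all of $\mathcal Y$, $\mathsf S(hA)$ denotes the continuous extension to $\mathcal Y$ (the bounded operator whose graph is the closure of the set of all such pairs $(U,\mathsf S(hA)U)$). Then there exist constants $\omega_{\mathsf S}>0$ and $h_*>0$ such that for all $h\in[0,h_*]$ the operator $\mathsf S(hA)$ is well defined and bounded on $\mathcal Y$, and for all $n\in\mathbb N_0$ $$\|\mathsf S^n(hA)\|_{\mathcal Y\to\mathcal Y}\le \mathrm e^{\omega_{\mathsf S}nh}.$$ -/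

import Mathlib

open Filter Topology

noncomputable section

namespace RKStab

/-! ### Runge-Kutta methods: stability function and A-stability -/

/-- The stability function `S(z) = 1 + z bᵀ (id - z a)⁻¹ 𝟙` of the Runge-Kutta method with
(real) coefficients `a`, `b`. -/
def stabilityFunction {s : ℕ} (a : Matrix (Fin s) (Fin s) ℝ) (b : Fin s → ℝ) (z : ℂ) : ℂ :=
  1 + z * dotProduct (fun i => (b i : ℂ))
    (Matrix.mulVec (1 - z • a.map (fun x : ℝ => (x : ℂ)))⁻¹ (fun _ => 1))

/-- `|S(z)| ≤ 1` on the closed left half-plane. -/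
def CondRK1 {s : ℕ} (a : Matrix (Fin s) (Fin s) ℝ) (b : Fin s → ℝ) : Prop :=
  ∀ z : ℂ, z.re ≤ 0 → ‖stabilityFunction a b z‖ ≤ 1

/-- `id - z a` is invertible for all `z` in the closed left half-plane. -/
def CondRK2 {s : ℕ} (a : Matrix (Fin s) (Fin s) ℝ) : Prop :=
  ∀ z : ℂ, z.re ≤ 0 → IsUnit (1 - z • a.map (fun x : ℝ => (x : ℂ)))

/-! ### Semigroups and their generators -/

section Operators

variable {𝕜 : Type*} [RCLike 𝕜] {Y : Type*} [NormedAddCommGroup Y] [InnerProductSpace 𝕜 Y]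

/-- `T t`, `t ≥ 0`, is a strongly continuous semigroup of bounded linear operators (the values
`T t` at `t < 0` are irrelevant). -/
structure IsC0Semigroup (T : ℝ → Y →L[𝕜] Y) : Prop where
  map_zero : T 0 = 1
  map_add : ∀ t u : ℝ, 0 ≤ t → 0 ≤ u → T (t + u) = T t * T u
  tendsto_zero : ∀ x : Y, Tendsto (fun t => T t x) (𝓝[>] 0) (𝓝 x)

/-- `A` is the infinitesimal generator of `T`: its domain consists of all `x` for which
`(T t x - x) / t` converges as `t ↓ 0`, and `A x` is that limit. -/
def IsGenerator (A : Y →ₗ.[𝕜] Y) (T : ℝ → Y →L[𝕜] Y) : Prop :=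
  ∀ x y : Y, (x, y) ∈ A.graph ↔
    Tendsto (fun t : ℝ => ((t⁻¹ : ℝ) : 𝕜) • (T t x - x)) (𝓝[>] 0) (𝓝 y)

/-- `A` is closed, densely defined, and generates a `C₀`-semigroup. -/
structure CondA0 (A : Y →ₗ.[𝕜] Y) : Prop where
  closed : A.IsClosed
  dense : Dense (A.domain : Set Y)
  generates : ∃ T : ℝ → Y →L[𝕜] Y, IsC0Semigroup T ∧ IsGenerator A T

/-! ### The scale `Y_k = D(A^k)` -/

/-- `A x` for `x` in the domain of `A` (and `0` elsewhere). -/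
def apply (A : Y →ₗ.[𝕜] Y) (x : Y) : Y :=
  open Classical in if hx : x ∈ A.domain then A ⟨x, hx⟩ else 0

/-- `D(A^k)`: the domain of the `k`-th power of `A`. -/
def powDomain (A : Y →ₗ.[𝕜] Y) : ℕ → Set Y
  | 0 => Set.univ
  | k + 1 => {x | x ∈ A.domain ∧ apply A x ∈ powDomain A k}

/-- The inner product of `Y_k = D(A^k)`, defined recursively by
`⟨x, y⟩_{k+1} = ⟨A x, A y⟩_k + ⟨x, y⟩_k`; used for `x, y ∈ D(A^k)` only. -/
def scaleInner (A : Y →ₗ.[𝕜] Y) : ℕ → Y → Y → 𝕜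
  | 0, x, y => inner 𝕜 x y
  | k + 1, x, y => scaleInner A k (apply A x) (apply A y) + scaleInner A k x y

/-- The norm of `Y_k = D(A^k)`. -/
def scaleNorm (A : Y →ₗ.[𝕜] Y) (k : ℕ) (x : Y) : ℝ :=
  Real.sqrt (RCLike.re (scaleInner A k x x))

/-- The linear map `B` restricts to a bounded linear operator on `Y_k = D(A^k)`. -/
def IsBoundedOnScale (A : Y →ₗ.[𝕜] Y) (B : Y →ₗ[𝕜] Y) (k : ℕ) : Prop :=
  ∃ C : ℝ, ∀ x ∈ powDomain A k,
    B x ∈ powDomain A k ∧ scaleNorm A k (B x) ≤ C * scaleNorm A k x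

/-! ### Normal operators and their bounded perturbations -/

/-- An unbounded operator `N` is normal if it is densely defined and closed, and `N* N = N N*`
(equality of unbounded operators, each product having its natural maximal domain). -/
structure IsNormalOperator [CompleteSpace Y] (N : Y →ₗ.[𝕜] Y) : Prop where
  dense : Dense (N.domain : Set Y)
  closed : N.IsClosed
  commute : ∀ x z : Y,
    (∃ y, (x, y) ∈ N.graph ∧ (y, z) ∈ N.adjoint.graph) ↔
      (∃ y, (x, y) ∈ N.adjoint.graph ∧ (y, z) ∈ N.graph)

/-- `A` generates a `C₀`-semigroup and `A = A_n + A_b` with `A_n` normal and `A_b` bounded on each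
of `Y_0, …, Y_K`. -/
def CondA2 [CompleteSpace Y] (A : Y →ₗ.[𝕜] Y) (K : ℕ) : Prop :=
  CondA0 A ∧ ∃ (An : Y →ₗ.[𝕜] Y) (Ab : Y →ₗ[𝕜] Y),
    A = An + Ab.toPMap ⊤ ∧ IsNormalOperator An ∧ ∀ k ≤ K, IsBoundedOnScale A Ab k

/-! ### The operator `S(hA)` -/

/-- The graph of `id + h bᵀ A (id - h a A)⁻¹ 𝟙` on its natural domain: the pairs `(U, V)` such that
there is a stage vector `W ∈ D(A)^s` with `W - h a A W = 𝟙 U` and `V = U + h bᵀ A W`. -/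
def stepGraph {s : ℕ} (a : Matrix (Fin s) (Fin s) ℝ) (b : Fin s → ℝ) (A : Y →ₗ.[𝕜] Y) (h : ℝ) :
    Set (Y × Y) :=
  {p | ∃ W : Fin s → A.domain,
    (∀ i, (W i : Y) - (h : 𝕜) • ∑ j, (a i j : 𝕜) • A (W j) = p.1) ∧
      p.2 = p.1 + (h : 𝕜) • ∑ j, (b j : 𝕜) • A (W j)}

/-- The bounded operator `S` on `Y` is `S(hA) = id + h bᵀ A (id - h a A)⁻¹ 𝟙`. If `a` is singular
or `h = 0`, the natural domain of the right-hand side need not be all of `Y`; `S(hA)` is then its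
continuous extension, whence the closure. -/
def IsStabilityOperator {s : ℕ} (a : Matrix (Fin s) (Fin s) ℝ) (b : Fin s → ℝ) (A : Y →ₗ.[𝕜] Y)
    (h : ℝ) (S : Y →L[𝕜] Y) : Prop :=
  closure (stepGraph a b A h) = {p : Y × Y | p.2 = S p.1}

/-- There is at most one operator `S(hA)`. -/
theorem IsStabilityOperator.unique {s : ℕ} {a : Matrix (Fin s) (Fin s) ℝ} {b : Fin s → ℝ}
    {A : Y →ₗ.[𝕜] Y} {h : ℝ} {S S' : Y →L[𝕜] Y} (hS : IsStabilityOperator a b A h S)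
    (hS' : IsStabilityOperator a b A h S') : S = S' := by
  ext x
  have hx : (x, S x) ∈ {p : Y × Y | p.2 = S' p.1} := by
    rw [← hS', hS]
    rfl
  exact hx

end Operators

end RKStab

end

open Filter Topology

noncomputable section

namespace RKStab

/-! ### Semigroups: growth bound, renorming, and the resolvent of the generator. -/

section Semigroup

variable {𝕜 : Type*} [RCLike 𝕜] {Y : Type*} [NormedAddCommGroup Y] [InnerProductSpace 𝕜 Y]
  {T : ℝ → Y →L[𝕜] Y}

/-! With w = (1 - z)⁻¹ the closed left half-plane becomes the disc |w - 1/2| ≤ 1/2 without 0, and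
the stability function becomes a quotient of real polynomials in w. Since |S| ≤ 1, zeros of the
denominator at w = 0 (that is, z = ∞) cancel, leaving p/q with q ≠ 0 and |p| ≤ |q| on the whole
closed disc. For G = (id - hA)⁻¹ this makes S(hA) = p(G) q(G)⁻¹, so everything reduces to ‖p(G)x‖ ≤
(1 + O(h)) ‖q(G)x‖ (`exists_stabilityOperator`).

This is proved first for G' = (id - hN)⁻¹, N the normal part of A. In an equivalent norm p the
semigroup is quasi-contractive, hence so are the resolvents of A and, after a bounded perturbation,
those of N; in the original norm ‖G'ⁿ‖ ≤ M (1 - hω)⁻ⁿ. But G' is normal, so its powers determine its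
norm and the factor M disappears (`norm_le_of_norm_pow_le_of_isStarNormal`). Consequently N - ω is
dissipative and ‖G' - c‖ ≤ c with c = 1/(2(1 - hω)) = 1/2 + O(h) (`exists_resolvent_estimates`). On
that slightly larger disc |p| ≤ (1 + O(h)) |q|, and the functional calculus of the normal operator
G' turns this into an operator inequality, after complexification so that real spaces are covered.

Finally G - G' = O(h), polynomials are Lipschitz on bounded sets of operators, and ‖q(G')x‖ ≥ κ‖x‖,
so the inequality passes to G with another factor 1 + O(h). Hence ‖S(hA)‖ ≤ 1 + Wh ≤ exp((W + 1)h).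
-/

theorem IsC0Semigroup.tendsto_nhdsGE (hT : IsC0Semigroup T) (x : Y) :
    Tendsto (fun t => T t x) (𝓝[≥] 0) (𝓝 x) := by
  have h : ContinuousWithinAt (fun t => T t x) (Set.Ioi 0) 0 := by
    have := hT.tendsto_zero x
    simpa [ContinuousWithinAt, hT.map_zero] using this
  have h' := continuousWithinAt_Ioi_iff_Ici.1 h
  simpa [ContinuousWithinAt, hT.map_zero] using h'

/-- Otherwise there are times tending to 0 along which the norms are unbounded, although the orbits
converge pointwise; this contradicts uniform boundedness. -/
theorem IsC0Semigroup.exists_bound_near_zero [CompleteSpace Y] (hT : IsC0Semigroup T) :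
    ∃ δ : ℝ, 0 < δ ∧ ∃ M : ℝ, ∀ t, 0 ≤ t → t ≤ δ → ‖T t‖ ≤ M := by
  by_contra! hcon
  choose t ht0 ht1 htM using fun n : ℕ => hcon (1 / ((n : ℝ) + 1)) (by positivity) n
  have htlim : Tendsto t atTop (𝓝[≥] 0) := by
    refine tendsto_nhdsWithin_iff.2 ⟨?_, Eventually.of_forall ht0⟩
    exact squeeze_zero ht0 ht1 tendsto_one_div_add_atTop_nhds_zero_nat
  obtain ⟨C, hC⟩ := banach_steinhaus (g := fun n => T (t n)) (by
    intro x
    have h1 : Tendsto (fun n => ‖T (t n) x‖) atTop (𝓝 ‖x‖) :=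
      ((hT.tendsto_nhdsGE x).comp htlim).norm
    obtain ⟨C, hC⟩ := h1.bddAbove_range
    exact ⟨C, fun n => hC ⟨n, rfl⟩⟩)
  obtain ⟨n, hn⟩ := exists_nat_gt C
  exact absurd (htM n) (not_lt.2 ((hC n).trans hn.le))

theorem IsC0Semigroup.exists_growth_bound [CompleteSpace Y] (hT : IsC0Semigroup T) :
    ∃ M ω : ℝ, 1 ≤ M ∧ 0 ≤ ω ∧ ∀ t, 0 ≤ t → ‖T t‖ ≤ M * Real.exp (ω * t) := by
  obtain ⟨δ, hδ, M₀, hM₀⟩ := hT.exists_bound_near_zero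
  set M := max M₀ 1 with hM
  have hM1 : 1 ≤ M := le_max_right _ _
  have hMpos : 0 < M := by linarith
  have key : ∀ n : ℕ, ∀ t : ℝ, 0 ≤ t → t ≤ (n + 1) * δ → ‖T t‖ ≤ M ^ (n + 1) := by
    intro n
    induction n with
    | zero =>
      intro t h0 h1
      have := (hM₀ t h0 (by simpa using h1)).trans (le_max_left M₀ 1)
      rwa [zero_add, pow_one]
    | succ n ih =>
      intro t h0 h1
      rcases le_total t δ with h | h
      · calc ‖T t‖ ≤ M := (hM₀ t h0 h).trans (le_max_left _ _)
          _ ≤ M ^ (n + 1 + 1) := le_self_pow₀ hM1 (by simp)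
      · have h2 : T t = T δ * T (t - δ) := by
          rw [← hT.map_add δ (t - δ) hδ.le (by linarith)]
          congr 1
          ring
        rw [h2, pow_succ']
        refine (norm_mul_le _ _).trans (mul_le_mul ((hM₀ δ hδ.le le_rfl).trans (le_max_left _ _))
          (ih _ (by linarith) ?_) (norm_nonneg _) hMpos.le)
        push_cast at h1
        linarith
  refine ⟨M, Real.log M / δ, hM1, div_nonneg (Real.log_nonneg hM1) hδ.le, fun t ht => ?_⟩
  have h1 := Nat.lt_floor_add_one (t / δ)
  have h2 := Nat.floor_le (div_nonneg ht hδ.le)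
  refine (key ⌊t / δ⌋₊ t ht ((div_le_iff₀ hδ).1 h1.le)).trans ?_
  rw [pow_succ']
  refine mul_le_mul_of_nonneg_left ?_ hMpos.le
  rw [← Real.exp_log (pow_pos hMpos _), Real.log_pow, Real.exp_le_exp]
  calc (⌊t / δ⌋₊ : ℝ) * Real.log M ≤ t / δ * Real.log M :=
        mul_le_mul_of_nonneg_right h2 (Real.log_nonneg hM1)
    _ = Real.log M / δ * t := by ring

theorem IsC0Semigroup.continuousOn [CompleteSpace Y] (hT : IsC0Semigroup T) (x : Y) :
    ContinuousOn (fun t => T t x) (Set.Ici 0) := by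
  obtain ⟨M, ω, hM, hω, hb⟩ := hT.exists_growth_bound
  intro t₀ ht₀
  have ht₀ : 0 ≤ t₀ := ht₀
  -- Using |t - t₀| treats both sides at once: for u ≤ v, T v - T u = T u (T (v - u) - 1).
  have habs : Tendsto (fun t : ℝ => |t - t₀|) (𝓝[Set.Ici 0] t₀) (𝓝[≥] 0) := by
    refine tendsto_nhdsWithin_iff.2 ⟨?_, Eventually.of_forall fun t => Set.mem_Ici.2 (abs_nonneg _)⟩
    have : ContinuousAt (fun t : ℝ => |t - t₀|) t₀ := by fun_prop
    simpa using this.tendsto.mono_left nhdsWithin_le_nhds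
  have hlim : Tendsto (fun t => M * Real.exp (ω * (t₀ + 1)) * ‖T |t - t₀| x - x‖)
      (𝓝[Set.Ici 0] t₀) (𝓝 0) := by
    have := (((hT.tendsto_nhdsGE x).comp habs).sub_const x).norm.const_mul
      (M * Real.exp (ω * (t₀ + 1)))
    simpa using this
  refine tendsto_iff_norm_sub_tendsto_zero.2 (squeeze_zero' (Eventually.of_forall fun t =>
    norm_nonneg _) ?_ hlim)
  have hev : ∀ᶠ t in 𝓝[Set.Ici 0] t₀, t < t₀ + 1 :=
    nhdsWithin_le_nhds (eventually_lt_nhds (by linarith))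
  filter_upwards [hev, self_mem_nhdsWithin] with t ht1 ht0
  have ht0 : 0 ≤ t := ht0
  have aux : ∀ u v : ℝ, 0 ≤ u → u ≤ v → u ≤ t₀ + 1 →
      ‖T v x - T u x‖ ≤ M * Real.exp (ω * (t₀ + 1)) * ‖T (v - u) x - x‖ := by
    intro u v hu huv hut
    have h2 : T v = T u * T (v - u) := by
      rw [← hT.map_add u (v - u) hu (by linarith)]
      congr 1
      ring
    have h3 : T v x - T u x = T u (T (v - u) x - x) := by
      rw [h2, map_sub]
      rfl
    rw [h3]
    refine ((T u).le_opNorm _).trans (mul_le_mul_of_nonneg_right ((hb u hu).trans ?_)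
      (norm_nonneg _))
    gcongr
  rcases le_total t t₀ with h | h
  · rw [norm_sub_rev, abs_sub_comm, abs_of_nonneg (by linarith)]
    exact aux t t₀ ht0 h ht1.le
  · rw [abs_of_nonneg (by linarith)]
    exact aux t₀ t ht₀ h (by linarith)

/-- For a `C₀`-semigroup there is an equivalent norm in which it is quasi-contractive. -/
theorem IsC0Semigroup.exists_renorming [CompleteSpace Y] (hT : IsC0Semigroup T) :
    ∃ (p : Y → ℝ) (M ω : ℝ), 1 ≤ M ∧ 0 ≤ ω ∧ (∀ x, ‖x‖ ≤ p x) ∧ (∀ x, p x ≤ M * ‖x‖) ∧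
      (∀ x y, p (x + y) ≤ p x + p y) ∧ (∀ (r : ℝ) x, 0 ≤ r → p ((r : 𝕜) • x) = r * p x) ∧
      ∀ t x, 0 ≤ t → p (T t x) ≤ Real.exp (ω * t) * p x := by
  obtain ⟨M, ω, hM, hω, hb⟩ := hT.exists_growth_bound
  -- The new norm is p x = sup over t ≥ 0 of exp(-ωt) ‖T t x‖. The term t = 0 gives ‖x‖ ≤ p x, and
  -- shifting t gives quasi-contractivity.
  let f : Y → {t : ℝ // 0 ≤ t} → ℝ := fun x t => Real.exp (-(ω * t)) * ‖T t x‖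
  have : Nonempty {t : ℝ // 0 ≤ t} := ⟨⟨0, le_rfl⟩⟩
  have hfb : ∀ x t, f x t ≤ M * ‖x‖ := by
    intro x t
    have h1 := (T t).le_of_opNorm_le (hb t t.2) x
    calc f x t ≤ Real.exp (-(ω * t)) * (M * Real.exp (ω * t) * ‖x‖) :=
          mul_le_mul_of_nonneg_left h1 (Real.exp_pos _).le
      _ = (Real.exp (-(ω * t)) * Real.exp (ω * t)) * (M * ‖x‖) := by ring
      _ = M * ‖x‖ := by rw [← Real.exp_add]; simp
  have hbdd : ∀ x, BddAbove (Set.range (f x)) := fun x =>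
    ⟨M * ‖x‖, by rintro _ ⟨t, rfl⟩; exact hfb x t⟩
  have hle : ∀ x t, f x t ≤ ⨆ t, f x t := fun x t => le_ciSup (hbdd x) t
  refine ⟨fun x => ⨆ t, f x t, M, ω, hM, hω, fun x => ?_, fun x => ciSup_le (hfb x),
    fun x y => ciSup_le fun t => ?_, fun r x hr => ?_, fun t x ht => ciSup_le fun u => ?_⟩
  · refine le_trans ?_ (hle x ⟨0, le_rfl⟩)
    simp [f, hT.map_zero]
  · refine le_trans ?_ (add_le_add (hle x t) (hle y t))
    simp only [f, ← mul_add]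
    rw [_root_.map_add]
    exact mul_le_mul_of_nonneg_left (norm_add_le _ _) (Real.exp_pos _).le
  · simp only
    rw [Real.mul_iSup_of_nonneg hr]
    congr 1
    ext t
    simp only [f, map_smul, norm_smul, RCLike.norm_ofReal, abs_of_nonneg hr]
    ring
  · have h1 : T u (T t x) = T (u + t) x := by
      rw [hT.map_add u t u.2 ht]
      rfl
    have h2 : f (T t x) u = Real.exp (ω * t) * f x ⟨u + t, add_nonneg u.2 ht⟩ := by
      simp only [f, h1, ← mul_assoc, ← Real.exp_add]
      congr 2
      ring
    rw [h2]
    exact mul_le_mul_of_nonneg_left (hle _ _) (Real.exp_pos _).le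

/-- The generator of a quasi-contractive semigroup is quasi-dissipative. -/
theorem IsGenerator.le_of_quasiContractive {A : Y →ₗ.[𝕜] Y} (hA : IsGenerator A T)
    {p : Y → ℝ} {M ω : ℝ} (hpM : ∀ x, p x ≤ M * ‖x‖)
    (hadd : ∀ x y, p (x + y) ≤ p x + p y)
    (hsmul : ∀ (r : ℝ) x, 0 ≤ r → p ((r : 𝕜) • x) = r * p x)
    (hT : ∀ t x, 0 ≤ t → p (T t x) ≤ Real.exp (ω * t) * p x) {x y : Y} (hxy : (x, y) ∈ A.graph)
    {l : ℝ} (hl : 0 ≤ l) : (l - ω) * p x ≤ p ((l : 𝕜) • x - y) := by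
  have hlim := (hA x y).1 hxy
  have hd : Tendsto (fun t : ℝ => t⁻¹ * (Real.exp (ω * t) - 1)) (𝓝[>] 0) (𝓝 ω) := by
    have h1 : HasDerivAt (fun t : ℝ => Real.exp (ω * t)) ω 0 := by
      simpa using ((hasDerivAt_id (0 : ℝ)).const_mul ω).exp
    simpa using h1.tendsto_slope_zero_right
  have hleft : Tendsto (fun t : ℝ => (l - t⁻¹ * (Real.exp (ω * t) - 1)) * p x
      - M * ‖((t⁻¹ : ℝ) : 𝕜) • (T t x - x) - y‖) (𝓝[>] 0) (𝓝 ((l - ω) * p x - M * ‖y - y‖)) :=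
    ((tendsto_const_nhds.sub hd).mul_const _).sub ((hlim.sub_const y).norm.const_mul M)
  rw [sub_self, norm_zero, mul_zero, sub_zero] at hleft
  refine le_of_tendsto hleft ?_
  filter_upwards [self_mem_nhdsWithin] with t ht
  have ht : 0 < t := ht
  set e := ((t⁻¹ : ℝ) : 𝕜) • (T t x - x) - y with he
  have hi : 0 ≤ t⁻¹ := (inv_pos.2 ht).le
  -- The difference-quotient error `e` tends to 0; the triangle inequality for p and p (T t x) ≤
  -- exp(ωt) p x then give the claim up to M‖e‖.
  have h1 : ((l + t⁻¹ : ℝ) : 𝕜) • x = ((l : 𝕜) • x - y) + (((t⁻¹ : ℝ) : 𝕜) • T t x - e) := by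
    rw [he]
    push_cast
    module
  have h2 : ((t⁻¹ : ℝ) : 𝕜) • T t x - e = ((t⁻¹ : ℝ) : 𝕜) • T t x + -e := sub_eq_add_neg _ _
  have h3 : (l + t⁻¹) * p x ≤ p ((l : 𝕜) • x - y) + (t⁻¹ * p (T t x) + M * ‖e‖) := by
    rw [← hsmul _ x (by positivity), h1]
    refine (hadd _ _).trans (add_le_add le_rfl ?_)
    rw [h2, ← hsmul _ (T t x) hi]
    refine (hadd _ _).trans (add_le_add le_rfl ?_)
    simpa using hpM (-e)
  have h4 := mul_le_mul_of_nonneg_left (hT t x ht.le) hi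
  nlinarith

/-- `(x, y)` belongs to the graph of the infinitesimal generator of `T`. -/
def HasGenerator (T : ℝ → Y →L[𝕜] Y) (x y : Y) : Prop :=
  Tendsto (fun t : ℝ => ((t⁻¹ : ℝ) : 𝕜) • (T t x - x)) (𝓝[>] 0) (𝓝 y)

/-- `L` is the integral of T over [0, 1]; shifting the interval and differentiating gives A L = T 1
- 1. -/
theorem IsC0Semigroup.exists_integral [NormedSpace ℝ Y] [IsScalarTower ℝ 𝕜 Y] [CompleteSpace Y]
    (hT : IsC0Semigroup T) :
    ∃ L : Y →L[𝕜] Y, (∀ x, HasGenerator T (L x) (T 1 x - x)) ∧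
      ∀ t, 0 ≤ t → Commute (T t) L := by
  obtain ⟨M, ω, hM, hω, hb⟩ := hT.exists_growth_bound
  -- The absolute value extends the orbit continuously to all of ℝ, as values of T at negative times
  -- are arbitrary.
  have hcont : ∀ x, Continuous fun t : ℝ => T |t| x := fun x =>
    (hT.continuousOn x).comp_continuous continuous_abs fun t => abs_nonneg t
  have hint : ∀ x u v, IntervalIntegrable (fun t : ℝ => T |t| x) MeasureTheory.volume u v :=
    fun x u v => (hcont x).intervalIntegrable u v
  let L₀ : Y →ₗ[𝕜] Y :=
    { toFun := fun x => ∫ t in (0 : ℝ)..1, T |t| x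
      map_add' := fun x y => by
        simp only [_root_.map_add]
        exact intervalIntegral.integral_add (hint x 0 1) (hint y 0 1)
      map_smul' := fun c x => by
        simp only [map_smul, RingHom.id_apply]
        exact intervalIntegral.integral_smul c _ }
  let L : Y →L[𝕜] Y := L₀.mkContinuous (M * Real.exp ω) (by
    intro x
    have : ‖∫ t in (0 : ℝ)..1, T |t| x‖ ≤ M * Real.exp ω * ‖x‖ * |(1 : ℝ) - 0| := by
      refine intervalIntegral.norm_integral_le_of_norm_le_const fun t ht => ?_
      rw [Set.uIoc_of_le zero_le_one] at ht
      refine (T |t|).le_of_opNorm_le ((hb _ (abs_nonneg _)).trans ?_) x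
      rw [abs_of_pos ht.1]
      have : ω * t ≤ ω := mul_le_of_le_one_right hω ht.2
      gcongr
    rw [sub_zero, abs_one, mul_one] at this
    exact this)
  have hL : ∀ x, L x = ∫ t in (0 : ℝ)..1, T |t| x := fun x => rfl
  have hTL : ∀ s x, 0 ≤ s → T s (L x) = ∫ t in (0 : ℝ)..1, T |t + s| x := by
    intro s x hs
    rw [hL, ← (T s).intervalIntegral_comp_comm (hint x 0 1)]
    refine intervalIntegral.integral_congr fun t ht => ?_
    rw [Set.uIcc_of_le zero_le_one] at ht
    rw [abs_of_nonneg ht.1, abs_of_nonneg (add_nonneg ht.1 hs), add_comm, hT.map_add s t hs ht.1]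
    rfl
  refine ⟨L, fun x => ?_, fun t ht => ?_⟩
  · let F : ℝ → Y := fun s => ∫ t in (0 : ℝ)..s, T |t| x
    have hF : ∀ s, HasDerivAt F (T |s| x) s := fun s =>
      ((hcont x).integral_hasStrictDerivAt 0 s).hasDerivAt
    have hF1 : HasDerivAt (fun s => F (1 + s)) (T 1 x) 0 := by
      have := (hF (1 + 0)).comp_const_add 1 0
      simpa using this
    have hF0 : HasDerivAt F x 0 := by simpa [hT.map_zero] using hF 0
    have h := (hF1.sub hF0).tendsto_slope_zero_right
    refine h.congr' ?_
    filter_upwards [self_mem_nhdsWithin] with s hs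
    have hs : 0 < s := hs
    have h1 : T s (L x) = F (1 + s) - F s := by
      rw [hTL s x hs.le, intervalIntegral.integral_comp_add_right (fun t => T |t| x)]
      have := intervalIntegral.integral_add_adjacent_intervals (hint x 0 s) (hint x s (1 + s))
      simp only [F, ← this]
      simp
    have h2 : F 0 = 0 := by simp [F]
    have h3 : L x = F 1 := rfl
    simp only [Pi.sub_apply, zero_add, add_zero]
    rw [h1, h2, h3, RCLike.real_smul_eq_coe_smul (K := 𝕜)]
    simp
  · ext x
    change T t (L x) = L (T t x)
    rw [hTL t x ht, hL]
    refine intervalIntegral.integral_congr fun u hu => ?_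
    rw [Set.uIcc_of_le zero_le_one] at hu
    rw [abs_of_nonneg hu.1, abs_of_nonneg (add_nonneg hu.1 ht), hT.map_add u t hu.1 ht]
    rfl

/-- If `T 1` is a strict contraction, the generator of `T` has a bounded inverse. -/
theorem IsC0Semigroup.exists_inverse_generator [CompleteSpace Y] (hT : IsC0Semigroup T)
    (h1 : ‖T 1‖ < 1) : ∃ R : Y →L[𝕜] Y, ∀ x y, HasGenerator T x y ↔ R y = x := by
  let _ : NormedSpace ℝ Y := NormedSpace.restrictScalars ℝ 𝕜 Y
  obtain ⟨L, hL, hcomm⟩ := hT.exists_integral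
  have hgenL : ∀ x y, HasGenerator T x y → HasGenerator T (L x) (L y) := by
    intro x y hxy
    have := (L.continuous.tendsto y).comp hxy
    refine this.congr' ?_
    filter_upwards [self_mem_nhdsWithin] with t ht
    have hc : T t (L x) = L (T t x) := congrArg (fun S : Y →L[𝕜] Y => S x) (hcomm t (le_of_lt ht))
    simp [hc]
  let u : (Y →L[𝕜] Y)ˣ := Units.oneSub (T 1) h1
  have hu : (u : Y →L[𝕜] Y) = 1 - T 1 := Units.val_oneSub _ h1
  have huL : Commute L (u : Y →L[𝕜] Y) := by
    rw [hu]
    exact (Commute.one_right L).sub_right (hcomm 1 zero_le_one).symm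
  have huL' : Commute L ((u⁻¹ : (Y →L[𝕜] Y)ˣ) : Y →L[𝕜] Y) := huL.units_inv_right
  have huapp : ∀ x, (u : Y →L[𝕜] Y) x = x - T 1 x := fun x => by rw [hu]; rfl
  have hui : ∀ x, (u : Y →L[𝕜] Y) (((u⁻¹ : (Y →L[𝕜] Y)ˣ) : Y →L[𝕜] Y) x) = x := fun x =>
    congrArg (fun S : Y →L[𝕜] Y => S x) u.mul_inv
  have hiu : ∀ x, ((u⁻¹ : (Y →L[𝕜] Y)ˣ) : Y →L[𝕜] Y) ((u : Y →L[𝕜] Y) x) = x := fun x =>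
    congrArg (fun S : Y →L[𝕜] Y => S x) u.inv_mul
  -- From A L = T 1 - 1, the inverse must be -L (1 - T 1)⁻¹.
  refine ⟨-(L * ((u⁻¹ : (Y →L[𝕜] Y)ˣ) : Y →L[𝕜] Y)), fun x y => ⟨fun hxy => ?_, fun hxy => ?_⟩⟩
  · have h2 : L y = T 1 x - x := tendsto_nhds_unique (hgenL x y hxy) (hL x)
    rw [huL'.eq]
    change -(((u⁻¹ : (Y →L[𝕜] Y)ˣ) : Y →L[𝕜] Y) (L y)) = x
    rw [h2, ← neg_sub, ← huapp, map_neg, hiu, neg_neg]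
  · have h2 := hL (((u⁻¹ : (Y →L[𝕜] Y)ˣ) : Y →L[𝕜] Y) (-y))
    rw [← neg_sub, ← huapp, hui, neg_neg, map_neg, map_neg] at h2
    rw [← hxy]
    exact h2

theorem IsC0Semigroup.rescale (hT : IsC0Semigroup T) (l : ℝ) :
    IsC0Semigroup fun t => ((Real.exp (-(l * t)) : ℝ) : 𝕜) • T t where
  map_zero := by simp [hT.map_zero]
  map_add := fun t u ht hu => by
    rw [hT.map_add t u ht hu, smul_mul_smul_comm, ← RCLike.ofReal_mul, ← Real.exp_add]
    congr 4
    ring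
  tendsto_zero := fun x => by
    have h1 : Tendsto (fun t : ℝ => ((Real.exp (-(l * t)) : ℝ) : 𝕜)) (𝓝[>] 0) (𝓝 1) := by
      have : Continuous fun t : ℝ => ((Real.exp (-(l * t)) : ℝ) : 𝕜) :=
        RCLike.continuous_ofReal.comp (by fun_prop)
      simpa using (this.tendsto 0).mono_left nhdsWithin_le_nhds
    simpa using h1.smul (hT.tendsto_zero x)

theorem HasGenerator.rescale (hT : IsC0Semigroup T) (l : ℝ) {x y : Y} (h : HasGenerator T x y) :
    HasGenerator (fun t => ((Real.exp (-(l * t)) : ℝ) : 𝕜) • T t) x (y - (l : 𝕜) • x) := by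
  have h1 : Tendsto (fun t : ℝ => ((t⁻¹ * (Real.exp (-(l * t)) - 1) : ℝ) : 𝕜)) (𝓝[>] 0)
      (𝓝 ((-l : ℝ) : 𝕜)) := by
    have hd : HasDerivAt (fun t : ℝ => Real.exp (-(l * t))) (-l) 0 := by
      simpa using ((hasDerivAt_id (0 : ℝ)).const_mul l).neg.exp
    refine (RCLike.continuous_ofReal.tendsto _).comp ?_
    simpa using hd.tendsto_slope_zero_right
  have h2 := h.add (h1.smul (hT.tendsto_zero x))
  have h3 : y - (l : 𝕜) • x = y + ((-l : ℝ) : 𝕜) • x := by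
    push_cast
    module
  rw [HasGenerator, h3]
  refine h2.congr fun t => ?_
  simp only [_root_.smul_apply]
  push_cast
  module

theorem HasGenerator.rescale_iff (hT : IsC0Semigroup T) (l : ℝ) {x y : Y} :
    HasGenerator (fun t => ((Real.exp (-(l * t)) : ℝ) : 𝕜) • T t) x (y - (l : 𝕜) • x) ↔
      HasGenerator T x y := by
  refine ⟨fun h => ?_, fun h => h.rescale hT l⟩
  have h1 := h.rescale (hT.rescale l) (-l)
  convert h1 using 1
  · funext t
    rw [smul_smul, ← RCLike.ofReal_mul, ← Real.exp_add]
    simp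
  · push_cast
    module

/-- The operator `G` is the resolvent `(id - h A)⁻¹`. -/
def IsScaledResolvent (A : Y →ₗ.[𝕜] Y) (h : ℝ) (G : Y →L[𝕜] Y) : Prop :=
  ∀ x y, (x, y) ∈ A.graph ↔ G (x - (h : 𝕜) • y) = x

/-- The semigroup exp(-t/h) T t has generator A - 1/h, and for small h its value at t = 1 is a
strict contraction. So A - 1/h is invertible, and (id - hA)⁻¹ = -h⁻¹ (A - 1/h)⁻¹. -/
theorem IsGenerator.exists_scaledResolvent [CompleteSpace Y] {A : Y →ₗ.[𝕜] Y}
    (hA : IsGenerator A T) (hT : IsC0Semigroup T) :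
    ∃ h₀ : ℝ, 0 < h₀ ∧ ∀ h, 0 < h → h ≤ h₀ → ∃ G : Y →L[𝕜] Y, IsScaledResolvent A h G := by
  have hpos : 0 < ‖T 1‖ + 1 := by positivity
  have hlog : 0 ≤ Real.log (‖T 1‖ + 1) := Real.log_nonneg (by linarith [norm_nonneg (T 1)])
  refine ⟨(Real.log (‖T 1‖ + 1) + 1)⁻¹, by positivity, fun h hh hle => ?_⟩
  have hl : Real.log (‖T 1‖ + 1) ≤ h⁻¹ := by
    have := (le_inv_comm₀ hh (by positivity)).1 hle
    linarith
  have hh' : (h : 𝕜) ≠ 0 := RCLike.ofReal_ne_zero.2 hh.ne'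
  obtain ⟨R, hR⟩ := (hT.rescale h⁻¹).exists_inverse_generator (by
    rw [norm_smul, RCLike.norm_ofReal, abs_of_pos (Real.exp_pos _), mul_one, Real.exp_neg,
      inv_mul_lt_iff₀ (Real.exp_pos _), mul_one]
    calc ‖T 1‖ < ‖T 1‖ + 1 := lt_add_one _
      _ = Real.exp (Real.log (‖T 1‖ + 1)) := (Real.exp_log hpos).symm
      _ ≤ Real.exp h⁻¹ := Real.exp_le_exp.2 hl)
  refine ⟨-((h⁻¹ : ℝ) : 𝕜) • R, fun x y => ?_⟩
  rw [show (x, y) ∈ A.graph ↔ HasGenerator T x y from hA x y,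
    ← HasGenerator.rescale_iff hT h⁻¹, hR, _root_.smul_apply, ← map_smul]
  have : y - ((h⁻¹ : ℝ) : 𝕜) • x = -((h⁻¹ : ℝ) : 𝕜) • (x - (h : 𝕜) • y) := by
    rw [smul_sub, smul_smul]
    push_cast
    rw [neg_mul, inv_mul_cancel₀ hh']
    module
  rw [this]

end Semigroup

/-! ### Bounded normal operators, and normality of resolvents. -/

section Normal

open ContinuousLinearMap

variable {𝕜 : Type*} [RCLike 𝕜] {Y : Type*} [NormedAddCommGroup Y] [InnerProductSpace 𝕜 Y]

/-- Normality gives (G*G)ᵏ = (Gᵏ)*Gᵏ, and G*G is self-adjoint, so ‖Gᵏ‖ = ‖G‖ᵏ for k = 2ⁿ. Letting n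
grow removes M, over real scalars as well. -/
theorem norm_le_of_norm_pow_le_of_isStarNormal [CompleteSpace Y] {G : Y →L[𝕜] Y}
    (hG : IsStarNormal G) {M r : ℝ} (hr : 0 < r) (h : ∀ n : ℕ, ‖G ^ n‖ ≤ M * r ^ n) :
    ‖G‖ ≤ r := by
  by_contra! hlt
  set ρ := (‖G‖ / r) ^ 2 with hρ
  have hρ1 : 1 < ρ := one_lt_pow₀ ((one_lt_div hr).2 hlt) two_ne_zero
  have key : ∀ n : ℕ, ρ ^ 2 ^ n ≤ M ^ 2 := by
    intro n
    have h1 := (IsSelfAdjoint.star_mul_self G).norm_pow_two_pow n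
    rw [hG.star_comm_self.mul_pow, ← star_pow, CStarRing.norm_star_mul_self,
      CStarRing.norm_star_mul_self] at h1
    have h2 := h (2 ^ n)
    have h3 : ‖G ^ 2 ^ n‖ * ‖G ^ 2 ^ n‖ ≤ (M * r ^ 2 ^ n) * (M * r ^ 2 ^ n) :=
      mul_le_mul h2 h2 (norm_nonneg _) ((norm_nonneg _).trans h2)
    rw [h1] at h3
    have hpos : 0 < (r ^ 2 ^ n) ^ 2 := by positivity
    rw [hρ, ← pow_mul, mul_comm 2, pow_mul, div_pow, div_pow, div_le_iff₀ hpos]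
    calc (‖G‖ ^ 2 ^ n) ^ 2 = (‖G‖ * ‖G‖) ^ 2 ^ n := by rw [mul_pow]; ring
      _ ≤ _ := h3
      _ = _ := by ring
  obtain ⟨n, hn⟩ := pow_unbounded_of_one_lt (M ^ 2) hρ1
  have h4 : ρ ^ n ≤ ρ ^ 2 ^ n := pow_le_pow_right₀ hρ1.le Nat.lt_two_pow_self.le
  linarith [key n]

/-- The bounded operator `G* G + (G - 1)* (G - 1)` is coercive. -/
theorem isUnit_adjoint_mul_self_add [CompleteSpace Y] (G : Y →L[𝕜] Y) :
    IsUnit (adjoint G * G + (adjoint G - 1) * (G - 1)) := by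
  refine isUnit_of_forall_le_norm_inner_map _ (c := 1 / 2) (by norm_num) fun x => ?_
  have h1 : inner 𝕜 ((adjoint G * G + (adjoint G - 1) * (G - 1) : Y →L[𝕜] Y) x) x =
      inner 𝕜 (G x) (G x) + inner 𝕜 (G x - x) (G x - x) := by
    simp only [_root_.add_apply, _root_.sub_apply, mul_apply_eq_comp, one_apply_eq_self]
    rw [inner_add_left, adjoint_inner_left, inner_sub_left, adjoint_inner_left,
      inner_sub_right (G x - x)]
  refine le_trans ?_ (RCLike.re_le_norm _)
  rw [h1, map_add, inner_self_eq_norm_sq, inner_self_eq_norm_sq]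
  have h2 : ‖x‖ ≤ ‖G x‖ + ‖G x - x‖ := by
    calc ‖x‖ = ‖G x - (G x - x)‖ := by congr 1; abel
      _ ≤ _ := norm_sub_le _ _
  have h3 : ‖x‖ ^ 2 ≤ (‖G x‖ + ‖G x - x‖) ^ 2 := pow_le_pow_left₀ (norm_nonneg _) h2 2
  push_cast
  nlinarith [sq_nonneg (‖G x‖ - ‖G x - x‖)]

/-- Normality of a (possibly unbounded) operator `N`, expressed by its bounded resolvent
`G = (id - N)⁻¹`, implies normality of `G`. -/
theorem isStarNormal_of_resolvent [CompleteSpace Y] {G : Y →L[𝕜] Y}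
    (hinj : Function.Injective G) (hinj' : Function.Injective (adjoint G))
    (hcomm : ∀ x z, (∃ y, G (x - y) = x ∧ adjoint G (y - z) = y) ↔
      ∃ y, adjoint G (x - y) = x ∧ G (y - z) = y) : IsStarNormal G := by
  -- Dictionary: `G (x - y) = x` says y = N x, and likewise for the adjoints. Formally P = G* (id +
  -- N*N) G.
  obtain ⟨P, hP⟩ := isUnit_adjoint_mul_self_add G
  have hPapp : ∀ v, (P : Y →L[𝕜] Y) v =
      adjoint G (G v) + (adjoint G (G v - v) - (G v - v)) := by
    intro v
    rw [hP]
    simp only [_root_.add_apply, _root_.sub_apply, mul_apply_eq_comp, one_apply_eq_self]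
  have hPi : ∀ x, (P : Y →L[𝕜] Y) (((P⁻¹ : (Y →L[𝕜] Y)ˣ) : Y →L[𝕜] Y) x) = x := fun x =>
    congrArg (fun S : Y →L[𝕜] Y => S x) P.mul_inv
  have hiP : ∀ x, ((P⁻¹ : (Y →L[𝕜] Y)ˣ) : Y →L[𝕜] Y) ((P : Y →L[𝕜] Y) x) = x := fun x =>
    congrArg (fun S : Y →L[𝕜] Y => S x) P.inv_mul
  -- `C = (id + N* N)⁻¹`
  let C : Y → Y := fun f => G (((P⁻¹ : (Y →L[𝕜] Y)ˣ) : Y →L[𝕜] Y) (adjoint G f))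
  have hCinj : Function.Injective C := by
    intro f g hfg
    have h1 := congrArg (P : Y →L[𝕜] Y) (hinj hfg)
    rw [hPi, hPi] at h1
    exact hinj' h1
  have hCsub : ∀ f g, C (f - g) = C f - C g := fun f g => by simp only [C, map_sub]
  have hC : ∀ f, ∃ y, G (C f - y) = C f ∧ adjoint G (y - (f - C f)) = y := by
    intro f
    set v := ((P⁻¹ : (Y →L[𝕜] Y)ˣ) : Y →L[𝕜] Y) (adjoint G f) with hv
    have hCf : C f = G v := rfl
    have h1 := hPapp v
    rw [hv, hPi, ← hv] at h1
    refine ⟨G v - v, by rw [hCf, sub_sub_cancel], ?_⟩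
    rw [hCf, map_sub, map_sub (adjoint G) f, h1]
    abel
  have hC' : ∀ x y z, G (x - y) = x → adjoint G (y - z) = y → C (x + z) = x := by
    intro x y z h1 h2
    have h3 : (P : Y →L[𝕜] Y) (x - y) = adjoint G (x + z) := by
      have h4 : adjoint G y = y + adjoint G z := by
        rw [map_sub] at h2
        exact sub_eq_iff_eq_add.1 h2
      rw [hPapp, h1, sub_sub_cancel, map_add, h4]
      abel
    simp only [C]
    rw [← h3, hiP, h1]
  have hD : ∀ f, ∃ y, adjoint G (C f - y) = C f ∧ G (y - (f - C f)) = y := fun f =>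
    (hcomm _ _).1 (hC f)
  have hD' : ∀ x y z, adjoint G (x - y) = x → G (y - z) = y → C (x + z) = x := by
    intro x y z h1 h2
    obtain ⟨y', h3, h4⟩ := (hcomm x z).2 ⟨y, h1, h2⟩
    exact hC' x y' z h3 h4
  -- For f = Gg, y = N C f satisfies (id + NN*) y = N f, hence C N f = N C f; this is commutation of
  -- C with the resolvent.
  have hCG : ∀ g, C (G g) = G (C g) := by
    intro g
    set f := G g with hf
    obtain ⟨y, hy1, hy2⟩ := hC f
    have h1 : C (y + (f - g - y)) = y := by
      refine hD' y (f - C f) _ hy2 ?_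
      rw [show f - C f - (f - g - y) = g - (C f - y) by abel, map_sub, hy1]
    rw [add_sub_cancel, hCsub] at h1
    rw [show C g = C f - y by rw [← h1]; abel, hy1]
  have hCG' : ∀ g, C (adjoint G g) = adjoint G (C g) := by
    intro g
    set f := adjoint G g with hf
    obtain ⟨y, hy1, hy2⟩ := hD f
    have h1 : C (y + (f - g - y)) = y := by
      refine hC' y (f - C f) _ hy2 ?_
      rw [show f - C f - (f - g - y) = g - (C f - y) by abel, map_sub, hy1]
    rw [add_sub_cancel, hCsub] at h1
    rw [show C g = C f - y by rw [← h1]; abel, hy1]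
  refine ⟨?_⟩
  ext f
  change adjoint G (G f) = G (adjoint G f)
  -- Applying C puts the vectors into D(N*N) = D(NN*). There (id - N*)(id - N)w and (id - N)(id -
  -- N*)w agree, and inverting the factors in either order gives the claim.
  apply hCinj
  rw [hCG', hCG]
  set w := C (G (adjoint G f)) with hw
  have hw' : w = G (adjoint G (C f)) := by rw [hw, hCG, hCG']
  obtain ⟨y, hy1, hy2⟩ := hC (G (adjoint G f))
  obtain ⟨y', hy1', hy2'⟩ := hD (G (adjoint G f))
  rw [← hw] at hy1 hy2 hy1' hy2'
  have h1 : w - y = adjoint G (C f) := hinj (hy1.trans hw')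
  have h2 : (w - y') - (y - (G (adjoint G f) - w)) = C f := by
    apply hinj'
    rw [← h1, show w - y' - (y - (G (adjoint G f) - w)) =
      (w - y') - (y - (G (adjoint G f) - w)) by abel, map_sub, hy1', hy2]
  have h3 : G (C f) = w - y' := by
    rw [← h2, show w - y' - (y - (G (adjoint G f) - w)) =
      (w - y) - (y' - (G (adjoint G f) - w)) by abel, map_sub, hy1, hy2']
  rw [h3, hy1']

end Normal

/-! ### Resolvents of unbounded operators and their adjoints. -/

section Resolvent

open ContinuousLinearMap

variable {𝕜 : Type*} [RCLike 𝕜] {Y : Type*} [NormedAddCommGroup Y] [InnerProductSpace 𝕜 Y]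
  {A N : Y →ₗ.[𝕜] Y} {h : ℝ} {G : Y →L[𝕜] Y}

theorem IsScaledResolvent.mem_graph (hG : IsScaledResolvent A h G) (hh : h ≠ 0) (u : Y) :
    (G u, ((h⁻¹ : ℝ) : 𝕜) • (G u - u)) ∈ A.graph := by
  have hh' : (h : 𝕜) ≠ 0 := RCLike.ofReal_ne_zero.2 hh
  refine (hG _ _).2 ?_
  rw [RCLike.ofReal_inv, smul_inv_smul₀ hh', sub_sub_cancel]

theorem IsScaledResolvent.injective (hG : IsScaledResolvent A h G) (hh : h ≠ 0) :
    Function.Injective G := by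
  refine (injective_iff_map_eq_zero G).2 fun u hu => ?_
  have h1 := hG.mem_graph hh u
  rw [hu] at h1
  have h2 := A.graph_fst_eq_zero_snd h1 rfl
  have hh' : ((h⁻¹ : ℝ) : 𝕜) ≠ 0 := RCLike.ofReal_ne_zero.2 (inv_ne_zero hh)
  simpa [hh'] using (smul_eq_zero.1 h2).resolve_left hh'

theorem IsScaledResolvent.range_eq (hG : IsScaledResolvent A h G) (hh : h ≠ 0) :
    Set.range G = A.domain := by
  ext x
  constructor
  · rintro ⟨u, rfl⟩
    exact LinearPMap.mem_domain_of_mem_graph (hG.mem_graph hh u)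
  · intro hx
    exact ⟨_, (hG _ _).1 (A.mem_graph ⟨x, hx⟩)⟩

theorem IsScaledResolvent.apply_eq (hG : IsScaledResolvent A h G) (hh : h ≠ 0)
    {u : Y} (x : A.domain) (hx : (x : Y) = G u) : (h : 𝕜) • A x = G u - u := by
  have h1 := (hG _ _).1 (A.mem_graph x)
  have h2 := hG.injective hh (h1.trans hx)
  rw [← hx, ← h2]
  abel

theorem IsScaledResolvent.denseRange (hG : IsScaledResolvent A h G) (hh : h ≠ 0)
    (hA : Dense (A.domain : Set Y)) : DenseRange G := by
  rw [DenseRange, hG.range_eq hh]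
  exact hA

theorem _root_.ContinuousLinearMap.adjoint_injective_of_denseRange [CompleteSpace Y]
    (hG : DenseRange G) : Function.Injective (adjoint G) := by
  refine (injective_iff_map_eq_zero _).2 fun u hu => ?_
  refine Dense.eq_zero_of_inner_left 𝕜 (S := Set.range G) hG ?_
  rintro _ ⟨v, rfl⟩
  rw [← adjoint_inner_left, hu, inner_zero_left]

/-- The graph of N consists of the pairs (Gu, h⁻¹(Gu - u)), so the condition defining the graph of
N* can be tested on these and moved onto G*. -/
theorem IsScaledResolvent.adjoint [CompleteSpace Y] (hG : IsScaledResolvent N h G) (hh : h ≠ 0)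
    (hN : Dense (N.domain : Set Y)) :
    IsScaledResolvent N.adjoint h (ContinuousLinearMap.adjoint G) := by
  have hh' : (h : 𝕜) ≠ 0 := RCLike.ofReal_ne_zero.2 hh
  intro x y
  rw [LinearPMap.adjoint_graph_eq_graph_adjoint hN, Submodule.mem_adjoint_iff]
  have key : ∀ u, inner 𝕜 (((h⁻¹ : ℝ) : 𝕜) • (G u - u)) x - inner 𝕜 (G u) y =
      (h : 𝕜)⁻¹ * inner 𝕜 u (ContinuousLinearMap.adjoint G (x - (h : 𝕜) • y) - x) := by
    intro u
    rw [inner_sub_right, adjoint_inner_right, inner_sub_right, inner_smul_right, inner_smul_left,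
      inner_sub_left, RCLike.conj_ofReal, RCLike.ofReal_inv]
    field_simp
    ring
  constructor
  · intro hxy
    refine sub_eq_zero.1 (inner_self_eq_zero (𝕜 := 𝕜).1 ?_)
    have := key (ContinuousLinearMap.adjoint G (x - (h : 𝕜) • y) - x)
    rw [hxy _ _ (hG.mem_graph hh _)] at this
    exact ((mul_eq_zero.1 this.symm).resolve_left (inv_ne_zero hh'))
  · intro hxy a b hab
    have h1 := (hG a b).1 hab
    have h2 := key (a - (h : 𝕜) • b)
    rw [hxy, sub_self, inner_zero_right, mul_zero, h1, sub_sub_cancel, RCLike.ofReal_inv,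
      inv_smul_smul₀ hh'] at h2
    exact h2

/-- Applies `isStarNormal_of_resolvent` to hN: the intermediate vector is rescaled by h⁻¹ and the
final one by h⁻². -/
theorem IsNormalOperator.isStarNormal_resolvent [CompleteSpace Y] (hN : IsNormalOperator N)
    (hG : IsScaledResolvent N h G) (hh : h ≠ 0) : IsStarNormal G := by
  have hh' : (h : 𝕜) ≠ 0 := RCLike.ofReal_ne_zero.2 hh
  have hG' := hG.adjoint hh hN.dense
  refine isStarNormal_of_resolvent (hG.injective hh)
    (adjoint_injective_of_denseRange (hG.denseRange hh hN.dense)) fun x z => ?_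
  have hc := hN.commute x ((h : 𝕜)⁻¹ • (h : 𝕜)⁻¹ • z)
  have key : ∀ (B : Y →ₗ.[𝕜] Y) (F : Y →L[𝕜] Y), IsScaledResolvent B h F → ∀ x y,
      (x, (h : 𝕜)⁻¹ • y) ∈ B.graph ↔ F (x - y) = x := fun B F hF x y => by
    rw [hF, smul_inv_smul₀ hh']
  have key' : ∀ (B : Y →ₗ.[𝕜] Y) (F : Y →L[𝕜] Y), IsScaledResolvent B h F → ∀ y z,
      ((h : 𝕜)⁻¹ • y, (h : 𝕜)⁻¹ • (h : 𝕜)⁻¹ • z) ∈ B.graph ↔ F (y - z) = y :=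
    fun B F hF x y => by
    rw [key B F hF, ← smul_sub, map_smul]
    exact (smul_right_injective Y (inv_ne_zero hh')).eq_iff
  have hsurj : Function.Surjective fun y : Y => (h : 𝕜)⁻¹ • y := fun y =>
    ⟨(h : 𝕜) • y, inv_smul_smul₀ hh' y⟩
  refine Iff.trans ?_ (hc.trans (Iff.trans hsurj.exists ?_))
  · refine Iff.trans ?_ hsurj.exists.symm
    simp only [key N G hG, key' _ _ hG']
  · simp only [key' N G hG, key _ _ hG']

end Resolvent

/-! ### Resolvent estimates for A and its normal part. -/

section Perturbation

open ContinuousLinearMap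

variable {𝕜 : Type*} [RCLike 𝕜] {Y : Type*} [NormedAddCommGroup Y] [InnerProductSpace 𝕜 Y]
  {A N : Y →ₗ.[𝕜] Y} {h ω M : ℝ} {G : Y →L[𝕜] Y} {p : Y → ℝ}

theorem IsScaledResolvent.renorm_le (hG : IsScaledResolvent N h G) (hh : 0 < h)
    (hsmul : ∀ (r : ℝ) x, 0 ≤ r → p ((r : 𝕜) • x) = r * p x)
    (hN : ∀ x y, (x, y) ∈ N.graph → ∀ l : ℝ, 0 ≤ l → (l - ω) * p x ≤ p ((l : 𝕜) • x - y))
    (u : Y) : (1 - h * ω) * p (G u) ≤ p u := by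
  have h1 := hN _ _ (hG.mem_graph hh.ne' u) h⁻¹ (inv_nonneg.2 hh.le)
  rw [← smul_sub, sub_sub_cancel, hsmul _ _ (inv_nonneg.2 hh.le)] at h1
  have h2 := mul_le_mul_of_nonneg_left h1 hh.le
  rw [mul_inv_cancel_left₀ hh.ne', ← mul_assoc, mul_sub, mul_inv_cancel₀ hh.ne'] at h2
  exact h2

/-- The one-step bound is iterated in p and compared with the original norm only at the ends, so M
is not raised to a power. -/
theorem IsScaledResolvent.norm_pow_le (hG : IsScaledResolvent N h G) (hh : 0 < h)
    (hω : h * ω < 1) (hM : 0 ≤ M) (hp : ∀ x, ‖x‖ ≤ p x) (hpM : ∀ x, p x ≤ M * ‖x‖)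
    (hsmul : ∀ (r : ℝ) x, 0 ≤ r → p ((r : 𝕜) • x) = r * p x)
    (hN : ∀ x y, (x, y) ∈ N.graph → ∀ l : ℝ, 0 ≤ l → (l - ω) * p x ≤ p ((l : 𝕜) • x - y))
    (n : ℕ) : ‖G ^ n‖ ≤ M * (1 - h * ω)⁻¹ ^ n := by
  have h0 : 0 < 1 - h * ω := by linarith
  have h1 : ∀ u, p ((G ^ n) u) ≤ (1 - h * ω)⁻¹ ^ n * p u := by
    induction n with
    | zero => simp
    | succ n ih =>
      intro u
      have h2 := hG.renorm_le hh hsmul hN ((G ^ n) u)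
      rw [pow_succ', pow_succ', mul_apply_eq_comp, mul_assoc, ← div_eq_inv_mul, le_div_iff₀ h0,
        mul_comm]
      exact h2.trans (ih u)
  refine opNorm_le_bound _ (by positivity) fun u => ?_
  calc ‖(G ^ n) u‖ ≤ (1 - h * ω)⁻¹ ^ n * p u := (hp _).trans (h1 u)
    _ ≤ (1 - h * ω)⁻¹ ^ n * (M * ‖u‖) := mul_le_mul_of_nonneg_left (hpM u) (by positivity)
    _ = _ := by ring

/-- If the resolvents of `N` satisfy `‖(id - h N)⁻¹‖ ≤ (1 - h ω)⁻¹` for small `h`, then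
`N - ω` is dissipative. -/
theorem re_inner_le_of_norm_resolvent_le {h₀ : ℝ} (hh₀ : 0 < h₀)
    (hG : ∀ h, 0 < h → h ≤ h₀ → ∃ G : Y →L[𝕜] Y, IsScaledResolvent N h G ∧
      0 < 1 - h * ω ∧ ‖G‖ ≤ (1 - h * ω)⁻¹) {x y : Y} (hxy : (x, y) ∈ N.graph) :
    RCLike.re (inner 𝕜 x y) ≤ ω * ‖x‖ ^ 2 := by
  -- Square (1 - hω)‖x‖ ≤ ‖x - hy‖, divide by h, and let h tend to 0.
  have key : ∀ h, 0 < h → h ≤ h₀ →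
      2 * (RCLike.re (inner 𝕜 x y) - ω * ‖x‖ ^ 2) ≤ h * ‖y‖ ^ 2 := by
    intro h hh hle
    obtain ⟨G, hG, hpos, hn⟩ := hG h hh hle
    have h1 := G.le_of_opNorm_le hn (x - (h : 𝕜) • y)
    rw [(hG x y).1 hxy, ← div_eq_inv_mul, le_div_iff₀ hpos, mul_comm] at h1
    have h2 := pow_le_pow_left₀ (mul_nonneg hpos.le (norm_nonneg x)) h1 2
    rw [norm_sub_sq (𝕜 := 𝕜), inner_smul_right, RCLike.re_ofReal_mul, norm_smul,
      RCLike.norm_ofReal, abs_of_pos hh] at h2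
    have h3 : h * (2 * (RCLike.re (inner 𝕜 x y) - ω * ‖x‖ ^ 2)) ≤ h * (h * ‖y‖ ^ 2) := by
      nlinarith [sq_nonneg (h * ω * ‖x‖)]
    exact le_of_mul_le_mul_left h3 hh
  have hlim : Tendsto (fun h : ℝ => h * ‖y‖ ^ 2) (𝓝[>] 0) (𝓝 (0 * ‖y‖ ^ 2)) :=
    ((continuous_id.mul continuous_const).tendsto 0).mono_left nhdsWithin_le_nhds
  have h1 := ge_of_tendsto hlim (b := 2 * (RCLike.re (inner 𝕜 x y) - ω * ‖x‖ ^ 2)) (by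
    filter_upwards [Ioc_mem_nhdsGT hh₀] with h hh
    exact key h hh.1 hh.2)
  linarith

/-- The numerical range of the resolvent of a quasi-dissipative operator lies in a disc. -/
theorem IsScaledResolvent.norm_sub_le (hG : IsScaledResolvent N h G) (hh : 0 < h)
    (hω : h * ω < 1)
    (hN : ∀ x y, (x, y) ∈ N.graph → RCLike.re (inner 𝕜 x y) ≤ ω * ‖x‖ ^ 2) :
    ‖G - (((2 * (1 - h * ω))⁻¹ : ℝ) : 𝕜) • (1 : Y →L[𝕜] Y)‖ ≤ (2 * (1 - h * ω))⁻¹ := by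
  set c := (2 * (1 - h * ω))⁻¹ with hc
  have h0 : 0 < 2 * (1 - h * ω) := by linarith
  have hcpos : 0 < c := inv_pos.2 h0
  refine opNorm_le_bound _ hcpos.le fun u => ?_
  simp only [_root_.sub_apply, _root_.smul_apply, one_apply_eq_self]
  -- Dissipativity at Gu reads (1 - hω)‖Gu‖² ≤ Re⟨Gu, u⟩; completing the square gives the disc.
  have h1 := hN _ _ (hG.mem_graph hh.ne' u)
  rw [inner_smul_right, RCLike.re_ofReal_mul, inner_sub_right, map_sub, inner_self_eq_norm_sq,
    ← div_eq_inv_mul, div_le_iff₀ hh] at h1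
  refine le_of_sq_le_sq ?_ (by positivity)
  rw [norm_sub_sq (𝕜 := 𝕜), inner_smul_right, RCLike.re_ofReal_mul, norm_smul,
    RCLike.norm_ofReal, abs_of_pos hcpos]
  have h2 : c * (2 * (1 - h * ω)) = 1 := inv_mul_cancel₀ h0.ne'
  have h3 : c * (2 * (1 - h * ω)) * ‖G u‖ ^ 2 ≤ c * (2 * RCLike.re (inner 𝕜 (G u) u)) := by
    rw [mul_assoc]
    exact mul_le_mul_of_nonneg_left (by linarith) hcpos.le
  rw [h2] at h3
  nlinarith

theorem mem_graph_add_toPMap {B : Y →ₗ[𝕜] Y} {x y : Y} :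
    (x, y + B x) ∈ (N + B.toPMap ⊤).graph ↔ (x, y) ∈ N.graph := by
  simp only [LinearPMap.mem_graph_iff]
  constructor
  · rintro ⟨⟨u, hu⟩, rfl, hu2⟩
    refine ⟨⟨u, hu.1⟩, rfl, ?_⟩
    exact add_right_cancel hu2
  · rintro ⟨⟨u, hu⟩, rfl, rfl⟩
    exact ⟨⟨u, ⟨hu, trivial⟩⟩, rfl, rfl⟩

/-- With A = N + B, (id - hA)(id + hGB) = id - hN, so G' = (id + hGB)⁻¹ G by a Neumann series. -/
theorem IsScaledResolvent.perturb [CompleteSpace Y] {B : Y →L[𝕜] Y}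
    (hG : IsScaledResolvent (N + (B : Y →ₗ[𝕜] Y).toPMap ⊤) h G)
    (hlt : ‖(h : 𝕜) • (G * B)‖ < 1) :
    ∃ G' : Y →L[𝕜] Y, IsScaledResolvent N h G' ∧ G - G' = (h : 𝕜) • (G * B * G') := by
  let u : (Y →L[𝕜] Y)ˣ := Units.oneSub (-((h : 𝕜) • (G * B))) (by rwa [norm_neg])
  have hu : (u : Y →L[𝕜] Y) = 1 + (h : 𝕜) • (G * B) := by
    rw [Units.val_oneSub, sub_neg_eq_add]
  refine ⟨((u⁻¹ : (Y →L[𝕜] Y)ˣ) : Y →L[𝕜] Y) * G, fun x y => ?_, ?_⟩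
  · have h1 : (u : Y →L[𝕜] Y) x = x + (h : 𝕜) • G (B x) := by
      rw [hu]
      rfl
    rw [← mem_graph_add_toPMap (B := (B : Y →ₗ[𝕜] Y)), hG]
    have h2 : ((u⁻¹ : (Y →L[𝕜] Y)ˣ) : Y →L[𝕜] Y) ((u : Y →L[𝕜] Y) x) = x :=
      congrArg (fun S : Y →L[𝕜] Y => S x) u.inv_mul
    have hinj : Function.Injective ((u⁻¹ : (Y →L[𝕜] Y)ˣ) : Y →L[𝕜] Y) := fun a b hab => by
      have h3 := congrArg (u : Y →L[𝕜] Y) hab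
      have h4 : ∀ z, (u : Y →L[𝕜] Y) (((u⁻¹ : (Y →L[𝕜] Y)ˣ) : Y →L[𝕜] Y) z) = z := fun z =>
        congrArg (fun S : Y →L[𝕜] Y => S z) u.mul_inv
      rwa [h4, h4] at h3
    rw [mul_apply_eq_comp]
    have h5 : ∀ z, ((u⁻¹ : (Y →L[𝕜] Y)ˣ) : Y →L[𝕜] Y) z = x ↔ z = (u : Y →L[𝕜] Y) x := fun z =>
      ⟨fun e => hinj (e.trans h2.symm), fun e => by rw [e, h2]⟩
    rw [h5, h1, coe_coe, smul_add, ← sub_sub, map_sub G _ ((h : 𝕜) • B x), map_smul,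
      sub_eq_iff_eq_add]
  · set G' := ((u⁻¹ : (Y →L[𝕜] Y)ˣ) : Y →L[𝕜] Y) * G with hG'
    have h1 : (u : Y →L[𝕜] Y) * G' = G := by rw [hG', ← mul_assoc, u.mul_inv, one_mul]
    rw [hu, add_mul, one_mul, smul_mul_assoc] at h1
    rw [← h1, add_sub_cancel_left, h1]

/-- The non-normal G is close to the normal G', whose disc does not involve the renorming constant M
other than through ω. This sharp disc is what permits a bound 1 + O(h) later. -/
theorem exists_resolvent_estimates [CompleteSpace Y] {T : ℝ → Y →L[𝕜] Y} (hT : IsC0Semigroup T)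
    (B : Y →L[𝕜] Y) (hA : IsGenerator (N + (B : Y →ₗ[𝕜] Y).toPMap ⊤) T)
    (hN : IsNormalOperator N) :
    ∃ ω C h₀ : ℝ, 0 ≤ ω ∧ 0 ≤ C ∧ 0 < h₀ ∧ ∀ h, 0 < h → h ≤ h₀ → h * ω ≤ 1 / 2 ∧
      ∃ G G' : Y →L[𝕜] Y, IsScaledResolvent (N + (B : Y →ₗ[𝕜] Y).toPMap ⊤) h G ∧
        IsStarNormal G' ∧ ‖G‖ ≤ C ∧ ‖G'‖ ≤ C ∧ ‖G - G'‖ ≤ C * h ∧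
        ‖G' - (((2 * (1 - h * ω))⁻¹ : ℝ) : 𝕜) • (1 : Y →L[𝕜] Y)‖ ≤ (2 * (1 - h * ω))⁻¹ := by
  obtain ⟨p, M, ω, hM, hω, hp, hpM, hadd, hsmul, hpT⟩ := hT.exists_renorming
  have hM0 : 0 ≤ M := by linarith
  have hp0 : ∀ x, 0 ≤ p x := fun x => (norm_nonneg x).trans (hp x)
  have hAp := fun x y (hxy : (x, y) ∈ (N + (B : Y →ₗ[𝕜] Y).toPMap ⊤).graph) (l : ℝ)
    (hl : 0 ≤ l) => hA.le_of_quasiContractive hpM hadd hsmul hpT hxy hl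
  set ω' := ω + M * ‖B‖ with hω'
  have hMB : 0 ≤ M * ‖B‖ := by positivity
  have hω'0 : 0 ≤ ω' := by positivity
  have hωω' : ω ≤ ω' := by linarith
  have hNp : ∀ x y, (x, y) ∈ N.graph → ∀ l : ℝ, 0 ≤ l →
      (l - ω') * p x ≤ p ((l : 𝕜) • x - y) := by
    intro x y hxy l hl
    have h1 := hAp x (y + B x) (mem_graph_add_toPMap.2 hxy) l hl
    have h2 := hadd ((l : 𝕜) • x - y) (-(B x))
    rw [← sub_eq_add_neg, sub_sub] at h2
    have h3 : p (-(B x)) ≤ M * ‖B‖ * p x := by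
      refine (hpM _).trans ?_
      rw [norm_neg, mul_assoc]
      exact mul_le_mul_of_nonneg_left ((B.le_opNorm x).trans
        (mul_le_mul_of_nonneg_left (hp x) (norm_nonneg _))) hM0
    rw [hω']
    nlinarith
  obtain ⟨h₁, hh₁, hres⟩ := hA.exists_scaledResolvent hT
  -- The three bounds ensure, in turn, that G exists, that hω' ≤ 1/2, and that ‖hGB‖ < 1.
  set h₀ := min h₁ (min (2 * (ω' + 1))⁻¹ (4 * (M * ‖B‖ + 1))⁻¹) with hh₀
  have hh₀pos : 0 < h₀ := by positivity
  have hle1 : ∀ h, 0 < h → h ≤ h₀ → h * ω' ≤ 1 / 2 := by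
    intro h hh hle
    have h1 : h ≤ (2 * (ω' + 1))⁻¹ := hle.trans ((min_le_right _ _).trans (min_le_left _ _))
    rw [le_inv_comm₀ hh (by positivity), ← one_div, le_div_iff₀ hh] at h1
    nlinarith
  have hle2 : ∀ h, 0 < h → h ≤ h₀ → h * (2 * M * ‖B‖) < 1 := by
    intro h hh hle
    have h1 : h ≤ (4 * (M * ‖B‖ + 1))⁻¹ := hle.trans ((min_le_right _ _).trans (min_le_right _ _))
    rw [le_inv_comm₀ hh (by positivity), ← one_div, le_div_iff₀ hh] at h1
    nlinarith
  have hinv : ∀ h, 0 < h → h ≤ h₀ → (1 - h * ω')⁻¹ ≤ 2 := by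
    intro h hh hle
    have := hle1 h hh hle
    rw [inv_le_comm₀ (by linarith) (by norm_num)]
    linarith
  have main : ∀ h, 0 < h → h ≤ h₀ → ∃ G G' : Y →L[𝕜] Y,
      IsScaledResolvent (N + (B : Y →ₗ[𝕜] Y).toPMap ⊤) h G ∧ IsScaledResolvent N h G' ∧
        IsStarNormal G' ∧ ‖G‖ ≤ 2 * M ∧ ‖G'‖ ≤ (1 - h * ω')⁻¹ ∧
        G - G' = (h : 𝕜) • (G * B * G') := by
    intro h hh hle
    have hlt := hle1 h hh hle
    obtain ⟨G, hG⟩ := hres h hh (hle.trans (min_le_left _ _))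
    have hGn : ‖G‖ ≤ 2 * M := by
      have hhω : h * ω ≤ h * ω' := mul_le_mul_of_nonneg_left hωω' hh.le
      have h2 := hG.norm_pow_le hh (by linarith) hM0 hp hpM hsmul hAp 1
      rw [pow_one, pow_one] at h2
      have h3 : (1 - h * ω)⁻¹ ≤ 2 := by
        rw [inv_le_comm₀ (by linarith) (by norm_num)]
        linarith
      nlinarith
    obtain ⟨G', hG', heq⟩ := hG.perturb (by
      rw [norm_smul, RCLike.norm_ofReal, abs_of_pos hh]
      refine lt_of_le_of_lt (mul_le_mul_of_nonneg_left ?_ hh.le) (hle2 h hh hle)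
      exact (norm_mul_le _ _).trans (mul_le_mul_of_nonneg_right hGn (norm_nonneg _)))
    have hnorm := hN.isStarNormal_resolvent hG' hh.ne'
    refine ⟨G, G', hG, hG', hnorm, hGn, ?_, heq⟩
    exact norm_le_of_norm_pow_le_of_isStarNormal hnorm (inv_pos.2 (by linarith))
      (hG'.norm_pow_le hh (by linarith) hM0 hp hpM hsmul hNp)
  have hdis : ∀ x y, (x, y) ∈ N.graph → RCLike.re (inner 𝕜 x y) ≤ ω' * ‖x‖ ^ 2 :=
    fun x y hxy => re_inner_le_of_norm_resolvent_le hh₀pos (fun h hh hle => by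
      obtain ⟨-, G', -, hG', -, -, hn, -⟩ := main h hh hle
      exact ⟨G', hG', by linarith [hle1 h hh hle], hn⟩) hxy
  refine ⟨ω', 2 * M + 4 * M * ‖B‖, h₀, hω'0, by positivity, hh₀pos,
    fun h hh hle => ⟨hle1 h hh hle, ?_⟩⟩
  obtain ⟨G, G', hG, hG', hnormal, hn, hn', heq⟩ := main h hh hle
  have hn2 := hn'.trans (hinv h hh hle)
  have hMB' : 0 ≤ 4 * M * ‖B‖ := by positivity
  refine ⟨G, G', hG, hnormal, by linarith, by linarith, ?_,
    hG'.norm_sub_le hh (by linarith [hle1 h hh hle]) hdis⟩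
  rw [heq, norm_smul, RCLike.norm_ofReal, abs_of_pos hh, mul_comm]
  refine mul_le_mul_of_nonneg_right ?_ hh.le
  calc ‖G * B * G'‖ ≤ ‖G‖ * ‖B‖ * ‖G'‖ := (norm_mul_le _ _).trans
        (mul_le_mul_of_nonneg_right (norm_mul_le _ _) (norm_nonneg _))
    _ ≤ 2 * M * ‖B‖ * 2 := by gcongr
    _ ≤ 2 * M + 4 * M * ‖B‖ := by linarith

end Perturbation

/-! ### Complexification, to bring real Hilbert spaces under the complex functional calculus. -/

section Complexification

/-- The complexification of `Y`, considered as a real space by restriction of scalars from `𝕜`. -/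
@[nolint unusedArguments]
def Complexify (_ : Type*) (Y : Type*) : Type _ := WithLp 2 (Y × Y)

namespace Complexify

variable {𝕜 Y : Type*}

/-- The vector `x + i y`. -/
def mk (x y : Y) : Complexify 𝕜 Y := WithLp.toLp 2 (x, y)

/-- The real part. -/
def fst (x : Complexify 𝕜 Y) : Y := (WithLp.ofLp x).1

/-- The imaginary part. -/
def snd (x : Complexify 𝕜 Y) : Y := (WithLp.ofLp x).2

theorem ext' {x y : Complexify 𝕜 Y} (h₁ : x.fst = y.fst) (h₂ : x.snd = y.snd) : x = y := by
  have : WithLp.ofLp x = WithLp.ofLp y := Prod.ext h₁ h₂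
  exact WithLp.ofLp_injective 2 this

@[simp] theorem fst_mk (x y : Y) : (mk x y : Complexify 𝕜 Y).fst = x := rfl
@[simp] theorem snd_mk (x y : Y) : (mk x y : Complexify 𝕜 Y).snd = y := rfl

variable [NormedAddCommGroup Y]

instance : NormedAddCommGroup (Complexify 𝕜 Y) :=
  inferInstanceAs (NormedAddCommGroup (WithLp 2 (Y × Y)))

instance [CompleteSpace Y] : CompleteSpace (Complexify 𝕜 Y) :=
  inferInstanceAs (CompleteSpace (WithLp 2 (Y × Y)))

@[simp] theorem fst_add (x y : Complexify 𝕜 Y) : (x + y).fst = x.fst + y.fst := rfl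
@[simp] theorem snd_add (x y : Complexify 𝕜 Y) : (x + y).snd = x.snd + y.snd := rfl
@[simp] theorem fst_zero : (0 : Complexify 𝕜 Y).fst = 0 := rfl
@[simp] theorem snd_zero : (0 : Complexify 𝕜 Y).snd = 0 := rfl

theorem norm_sq (x : Complexify 𝕜 Y) : ‖x‖ ^ 2 = ‖x.fst‖ ^ 2 + ‖x.snd‖ ^ 2 :=
  WithLp.prod_norm_sq_eq_of_L2 (x : WithLp 2 (Y × Y))

theorem norm_mk_zero (x : Y) : ‖(mk x 0 : Complexify 𝕜 Y)‖ = ‖x‖ := by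
  have h := norm_sq (mk x 0 : Complexify 𝕜 Y)
  rw [fst_mk, snd_mk, norm_zero, zero_pow two_ne_zero, add_zero] at h
  exact (pow_left_inj₀ (norm_nonneg _) (norm_nonneg _) two_ne_zero).1 h

variable [RCLike 𝕜] [InnerProductSpace 𝕜 Y]

/-- Only real scalars act on the components, so for `𝕜 = ℂ` the new imaginary unit is unrelated to
that of `Y`. The construction is thus uniform in `𝕜`, and the inner product below uses only real
parts. -/
instance : SMul ℂ (Complexify 𝕜 Y) :=
  ⟨fun c x => mk ((c.re : 𝕜) • x.fst - (c.im : 𝕜) • x.snd)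
    ((c.re : 𝕜) • x.snd + (c.im : 𝕜) • x.fst)⟩

@[simp] theorem fst_smul (c : ℂ) (x : Complexify 𝕜 Y) :
    (c • x).fst = (c.re : 𝕜) • x.fst - (c.im : 𝕜) • x.snd := rfl
@[simp] theorem snd_smul (c : ℂ) (x : Complexify 𝕜 Y) :
    (c • x).snd = (c.re : 𝕜) • x.snd + (c.im : 𝕜) • x.fst := rfl

instance : Module ℂ (Complexify 𝕜 Y) where
  one_smul x := by apply ext' <;> simp
  mul_smul c d x := by
    apply ext' <;> simp only [fst_smul, snd_smul, Complex.mul_re, Complex.mul_im] <;> push_cast <;>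
      module
  smul_zero c := by apply ext' <;> simp
  smul_add c x y := by
    apply ext' <;> simp only [fst_smul, snd_smul, fst_add, snd_add] <;> module
  add_smul c d x := by
    apply ext' <;> simp only [fst_smul, snd_smul, fst_add, snd_add, Complex.add_re,
      Complex.add_im] <;> push_cast <;> module
  zero_smul x := by apply ext' <;> simp

instance : NormedSpace ℂ (Complexify 𝕜 Y) where
  norm_smul_le c x := by
    refine le_of_sq_le_sq (le_of_eq ?_) (by positivity)
    rw [mul_pow, norm_sq, norm_sq, fst_smul, snd_smul, norm_sub_sq (𝕜 := 𝕜),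
      norm_add_sq (𝕜 := 𝕜), inner_smul_left, inner_smul_right, inner_smul_left, inner_smul_right,
      RCLike.conj_ofReal, RCLike.re_ofReal_mul, RCLike.re_ofReal_mul,
      RCLike.re_ofReal_mul, RCLike.re_ofReal_mul, inner_re_symm (x := x.snd), Complex.sq_norm,
      Complex.normSq_apply]
    simp only [norm_smul, RCLike.norm_ofReal, mul_pow, sq_abs]
    ring

instance : InnerProductSpace ℂ (Complexify 𝕜 Y) where
  inner x y := ⟨RCLike.re (inner 𝕜 x.fst y.fst) + RCLike.re (inner 𝕜 x.snd y.snd),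
    RCLike.re (inner 𝕜 x.fst y.snd) - RCLike.re (inner 𝕜 x.snd y.fst)⟩
  norm_sq_eq_re_inner x := by
    rw [norm_sq, ← inner_self_eq_norm_sq (𝕜 := 𝕜) x.fst, ← inner_self_eq_norm_sq (𝕜 := 𝕜) x.snd]
    rfl
  conj_inner_symm x y := by
    apply Complex.ext
    · simp [inner_re_symm (𝕜 := 𝕜) x.fst, inner_re_symm (𝕜 := 𝕜) x.snd]
    · simp [inner_re_symm (𝕜 := 𝕜) x.fst, inner_re_symm (𝕜 := 𝕜) x.snd]
  add_left x y z := by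
    apply Complex.ext <;>
      simp only [fst_add, snd_add, inner_add_left, map_add, Complex.add_re, Complex.add_im] <;> ring
  smul_left x y c := by
    apply Complex.ext <;>
      simp only [fst_smul, snd_smul, inner_add_left, inner_sub_left, inner_smul_left,
        RCLike.conj_ofReal, map_add, map_sub, RCLike.re_ofReal_mul, Complex.mul_re, Complex.mul_im,
        Complex.conj_re, Complex.conj_im] <;> ring

theorem inner_def (x y : Complexify 𝕜 Y) : inner ℂ x y =
    ⟨RCLike.re (inner 𝕜 x.fst y.fst) + RCLike.re (inner 𝕜 x.snd y.snd),
    RCLike.re (inner 𝕜 x.fst y.snd) - RCLike.re (inner 𝕜 x.snd y.fst)⟩ := rfl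

theorem norm_le_of_components {G : Y →L[𝕜] Y} (x y : Complexify 𝕜 Y) (h₁ : y.fst = G x.fst)
    (h₂ : y.snd = G x.snd) : ‖y‖ ≤ ‖G‖ * ‖x‖ := by
  refine le_of_sq_le_sq ?_ (by positivity)
  rw [norm_sq, h₁, h₂, mul_pow, norm_sq, mul_add, ← mul_pow, ← mul_pow]
  gcongr <;> exact G.le_opNorm _

/-- The complexification of a bounded operator. -/
def map : (Y →L[𝕜] Y) →+* (Complexify 𝕜 Y →L[ℂ] Complexify 𝕜 Y) where
  toFun G := LinearMap.mkContinuous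
    { toFun := fun x => mk (G x.fst) (G x.snd)
      map_add' := fun x y => by apply ext' <;> simp
      map_smul' := fun c x => by apply ext' <;> simp } ‖G‖
    fun x => norm_le_of_components x _ rfl rfl
  map_one' := rfl
  map_mul' _ _ := rfl
  map_zero' := rfl
  map_add' _ _ := rfl

theorem map_apply (G : Y →L[𝕜] Y) (x : Complexify 𝕜 Y) : map G x = mk (G x.fst) (G x.snd) := rfl

theorem norm_map_le (G : Y →L[𝕜] Y) : ‖map G‖ ≤ ‖G‖ :=
  LinearMap.mkContinuous_norm_le _ (norm_nonneg _) fun x => norm_le_of_components x _ rfl rfl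

theorem map_ofReal_smul_one (r : ℝ) :
    map ((r : 𝕜) • (1 : Y →L[𝕜] Y)) = (r : ℂ) • (1 : Complexify 𝕜 Y →L[ℂ] Complexify 𝕜 Y) := by
  ext x
  apply ext'
  · change (r : 𝕜) • x.fst = (((r : ℂ).re : ℝ) : 𝕜) • x.fst - (((r : ℂ).im : ℝ) : 𝕜) • x.snd
    simp
  · change (r : 𝕜) • x.snd = (((r : ℂ).re : ℝ) : 𝕜) • x.snd + (((r : ℂ).im : ℝ) : 𝕜) • x.fst
    simp

theorem adjoint_map [CompleteSpace Y] (G : Y →L[𝕜] Y) :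
    ContinuousLinearMap.adjoint (map G) = map (ContinuousLinearMap.adjoint G) := by
  symm
  rw [ContinuousLinearMap.eq_adjoint_iff]
  intro x y
  simp only [inner_def, map_apply, fst_mk, snd_mk, ContinuousLinearMap.adjoint_inner_left]

theorem isStarNormal_map [CompleteSpace Y] {G : Y →L[𝕜] Y} (hG : IsStarNormal G) :
    IsStarNormal (map G) := by
  refine ⟨?_⟩
  rw [ContinuousLinearMap.star_eq_adjoint, adjoint_map]
  exact hG.star_comm_self.map map

end Complexify

end Complexification

/-! ### Polynomials of bounded operators. -/

section PolynomialCalculus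

open Polynomial

variable {𝕜 : Type*} [RCLike 𝕜] {Y : Type*} [NormedAddCommGroup Y] [InnerProductSpace 𝕜 Y]

/-- Evaluation of real polynomials at a bounded operator. -/
def polyOp (G : Y →L[𝕜] Y) : ℝ[X] →+* (Y →L[𝕜] Y) :=
  (aeval G : 𝕜[X] →ₐ[𝕜] (Y →L[𝕜] Y)).toRingHom.comp (mapRingHom (algebraMap ℝ 𝕜))

@[simp] theorem polyOp_X (G : Y →L[𝕜] Y) : polyOp G X = G := by
  simp [polyOp]

@[simp] theorem polyOp_C (G : Y →L[𝕜] Y) (r : ℝ) :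
    polyOp G (C r) = (r : 𝕜) • (1 : Y →L[𝕜] Y) := by
  simp [polyOp, Algebra.algebraMap_eq_smul_one]

theorem spectrum_subset_closedBall [CompleteSpace Y] [Nontrivial Y] {G : Y →L[𝕜] Y} {c : 𝕜}
    {r : ℝ} (h : ‖G - c • (1 : Y →L[𝕜] Y)‖ ≤ r) : spectrum 𝕜 G ⊆ Metric.closedBall c r := by
  intro z hz
  have h1 : z - c ∈ spectrum 𝕜 (G - algebraMap 𝕜 (Y →L[𝕜] Y) c) := by
    rw [← spectrum.sub_singleton_eq]
    exact Set.sub_mem_sub hz rfl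
  rw [Algebra.algebraMap_eq_smul_one] at h1
  rw [mem_closedBall_iff_norm]
  exact (spectrum.norm_le_norm_of_mem h1).trans h

/-- The spectrum lies in the disc, where p/q is continuous and bounded by K; so p(G) = (p/q)(G) q(G)
with ‖(p/q)(G)‖ ≤ K. -/
theorem norm_aeval_le_of_isStarNormal {H : Type*} [NormedAddCommGroup H] [InnerProductSpace ℂ H]
    [CompleteSpace H] {G : H →L[ℂ] H} (hG : IsStarNormal G) {c : ℂ} {r K : ℝ} (hK : 0 ≤ K)
    (hGc : ‖G - c • (1 : H →L[ℂ] H)‖ ≤ r) {p q : ℂ[X]}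
    (hq : ∀ z ∈ Metric.closedBall c r, q.eval z ≠ 0)
    (hpq : ∀ z ∈ Metric.closedBall c r, ‖p.eval z‖ ≤ K * ‖q.eval z‖) (x : H) :
    ‖aeval G p x‖ ≤ K * ‖aeval G q x‖ := by
  cases subsingleton_or_nontrivial H
  · rw [Subsingleton.elim (aeval G p x) 0, norm_zero]
    positivity
  have hs := spectrum_subset_closedBall hGc
  have hcont : ContinuousOn (fun z => p.eval z / q.eval z) (spectrum ℂ G) :=
    p.continuous.continuousOn.div q.continuous.continuousOn fun z hz => hq z (hs hz)
  have h1 : aeval G p = cfc (fun z => p.eval z / q.eval z) G * aeval G q := by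
    rw [← cfc_polynomial p G, ← cfc_polynomial q G, ← cfc_mul _ _ G hcont
      q.continuous.continuousOn]
    exact cfc_congr fun z hz => (div_mul_cancel₀ _ (hq z (hs hz))).symm
  have h2 : ‖cfc (fun z => p.eval z / q.eval z) G‖ ≤ K := norm_cfc_le hK fun z hz => by
    rw [norm_div, div_le_iff₀ (norm_pos_iff.2 (hq z (hs hz)))]
    exact hpq z (hs hz)
  rw [h1, mul_apply_eq_comp]
  exact ContinuousLinearMap.le_of_opNorm_le _ h2 _

/-- For a normal operator on a real or complex Hilbert space, a pointwise inequality between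
real polynomials on a disc containing the numerical range gives an operator inequality. -/
theorem norm_polyOp_le_of_isStarNormal [CompleteSpace Y] {G : Y →L[𝕜] Y} (hG : IsStarNormal G)
    {c r K : ℝ} (hK : 0 ≤ K) (hGc : ‖G - (c : 𝕜) • (1 : Y →L[𝕜] Y)‖ ≤ r) {p q : ℝ[X]}
    (hq : ∀ z ∈ Metric.closedBall (c : ℂ) r, aeval z q ≠ 0)
    (hpq : ∀ z ∈ Metric.closedBall (c : ℂ) r, ‖aeval z p‖ ≤ K * ‖aeval z q‖) (x : Y) :
    ‖polyOp G p x‖ ≤ K * ‖polyOp G q x‖ := by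
  have hmap : ∀ p : ℝ[X], aeval (Complexify.map G) (p.map (algebraMap ℝ ℂ)) =
      Complexify.map (polyOp G p) := by
    intro p
    have h1 : (((aeval (Complexify.map G) : ℂ[X] →ₐ[ℂ] _).toRingHom.comp
        (mapRingHom (algebraMap ℝ ℂ))) : ℝ[X] →+* _) = Complexify.map.comp (polyOp G) := by
      apply Polynomial.ringHom_ext
      · intro r
        simp only [RingHom.comp_apply, polyOp_C, Complexify.map_ofReal_smul_one]
        simp [Algebra.algebraMap_eq_smul_one]
      · simp
    exact congrArg (fun f => f p) h1
  have hnorm : ∀ p : ℝ[X], ‖aeval (Complexify.map G) (p.map (algebraMap ℝ ℂ))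
      (Complexify.mk x 0)‖ = ‖polyOp G p x‖ := by
    intro p
    rw [hmap, Complexify.map_apply, Complexify.fst_mk, Complexify.snd_mk, map_zero,
      Complexify.norm_mk_zero]
  rw [← hnorm, ← hnorm]
  refine norm_aeval_le_of_isStarNormal (Complexify.isStarNormal_map hG) hK (c := (c : ℂ)) (r := r)
    ?_ ?_ ?_ _
  · rw [← Complexify.map_ofReal_smul_one, ← map_sub]
    exact (Complexify.norm_map_le _).trans hGc
  · intro z hz
    rw [eval_map_algebraMap]
    exact hq z hz
  · intro z hz
    rw [eval_map_algebraMap, eval_map_algebraMap]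
    exact hpq z hz

/-- Needed to carry estimates from the normal resolvent to the nearby non-normal one, with a
constant independent of h. -/
theorem norm_polyOp_le_and_lipschitz (p : ℝ[X]) (ρ : ℝ) : ∃ L : ℝ, 0 ≤ L ∧
    ∀ (G G' : Y →L[𝕜] Y), ‖G‖ ≤ ρ → ‖G'‖ ≤ ρ →
      ‖polyOp G p‖ ≤ L ∧ ‖polyOp G p - polyOp G' p‖ ≤ L * ‖G - G'‖ := by
  induction p using Polynomial.induction_on' with
  | add p q hp hq =>
    obtain ⟨L₁, h₁, hp⟩ := hp
    obtain ⟨L₂, h₂, hq⟩ := hq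
    refine ⟨L₁ + L₂, by positivity, fun G G' hG hG' => ?_⟩
    obtain ⟨a, b⟩ := hp G G' hG hG'
    obtain ⟨a', b'⟩ := hq G G' hG hG'
    rw [map_add, map_add]
    constructor
    · exact norm_add_le_of_le a a'
    · rw [add_sub_add_comm, add_mul]
      exact norm_add_le_of_le b b'
  | monomial n r =>
    induction n with
    | zero =>
      refine ⟨|r|, abs_nonneg _, fun G G' hG hG' => ?_⟩
      rw [monomial_zero_left, polyOp_C, polyOp_C, sub_self, norm_zero, norm_smul,
        RCLike.norm_ofReal]
      exact ⟨mul_le_of_le_one_right (abs_nonneg _) ContinuousLinearMap.norm_id_le, by positivity⟩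
    | succ n ih =>
      obtain ⟨L, hL, h⟩ := ih
      refine ⟨L * |ρ| + L, by positivity, fun G G' hG hG' => ?_⟩
      obtain ⟨a, b⟩ := h G G' hG hG'
      obtain ⟨a', -⟩ := h G' G hG' hG
      have hmul : ∀ F : Y →L[𝕜] Y, polyOp F (monomial (n + 1) r) = polyOp F (monomial n r) * F := by
        intro F
        rw [← monomial_mul_X, map_mul, polyOp_X]
      have hG1 := hG.trans (le_abs_self ρ)
      rw [hmul, hmul]
      constructor
      · have := (norm_mul_le _ _).trans (mul_le_mul a hG1 (norm_nonneg _) hL)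
        linarith
      · have h1 : polyOp G (monomial n r) * G - polyOp G' (monomial n r) * G' =
            (polyOp G (monomial n r) - polyOp G' (monomial n r)) * G +
              polyOp G' (monomial n r) * (G - G') := by noncomm_ring
        rw [h1, add_mul]
        refine norm_add_le_of_le ?_ ?_
        · refine (norm_mul_le _ _).trans ((mul_le_mul b hG1 (norm_nonneg _) (by positivity)).trans
            (le_of_eq (by ring)))
        · exact (norm_mul_le _ _).trans (mul_le_mul_of_nonneg_right a' (norm_nonneg _))

end PolynomialCalculus

/-! ### The stability function as a rational function of w. -/

section StagePolynomials

open Polynomial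

variable {s : ℕ} (a : Matrix (Fin s) (Fin s) ℝ) (b : Fin s → ℝ)

/-- The matrix `w id - (w - 1) a`, which is `w (id - z a)` for `w = (1 - z)⁻¹`. -/
def stageMatrix : Matrix (Fin s) (Fin s) ℝ[X] :=
  (X : ℝ[X]) • (1 : Matrix (Fin s) (Fin s) ℝ[X]) - (X - 1 : ℝ[X]) • a.map C

/-- The denominator of the stability function in terms of `w = (1 - z)⁻¹`. -/
def stageDen : ℝ[X] := (stageMatrix a).det

/-- The numerator of the stability function in terms of `w = (1 - z)⁻¹`. -/
def stageNum : ℝ[X] :=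
  stageDen a + (X - 1) * ∑ j, C (b j) * ∑ i, (stageMatrix a).adjugate j i

variable {a b}

/-- At w the stage matrix is w (id - z a) with z = 1 - w⁻¹. Its adjugate is its determinant times
w⁻¹ (id - z a)⁻¹, and the factor w - 1 = w z of the numerator absorbs w⁻¹. -/
theorem aeval_stage (w : ℂ) (hw : w ≠ 0)
    (hunit : IsUnit (1 - (1 - w⁻¹) • a.map (fun x : ℝ => (x : ℂ)))) :
    aeval w (stageDen a) ≠ 0 ∧
      aeval w (stageNum a b) = aeval w (stageDen a) * stabilityFunction a b (1 - w⁻¹) := by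
  set N : Matrix (Fin s) (Fin s) ℂ := 1 - (1 - w⁻¹) • a.map (fun x : ℝ => (x : ℂ)) with hN
  let φ : ℝ[X] →+* ℂ := (aeval w : ℝ[X] →ₐ[ℝ] ℂ).toRingHom
  have hφ : ∀ p, φ p = aeval w p := fun p => rfl
  have hM : φ.mapMatrix (stageMatrix a) = w • N := by
    ext i j
    simp only [stageMatrix, RingHom.mapMatrix_apply, Matrix.map_apply, Matrix.sub_apply,
      Matrix.smul_apply, smul_eq_mul, map_sub, map_mul, map_one, hN, hφ, aeval_X, aeval_C,
      Complex.coe_algebraMap, Matrix.one_apply]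
    by_cases hij : i = j
    · simp only [hij, if_true, map_one]
      field_simp
    · simp only [hij, if_false, map_zero]
      field_simp
  have hNdet : IsUnit N.det := (Matrix.isUnit_iff_isUnit_det N).1 hunit
  have hdet : aeval w (stageDen a) = w ^ s * N.det := by
    rw [← hφ, stageDen, RingHom.map_det, hM, Matrix.det_smul, Fintype.card_fin]
  have hdet0 : aeval w (stageDen a) ≠ 0 := by
    rw [hdet]
    exact mul_ne_zero (pow_ne_zero _ hw) hNdet.ne_zero
  refine ⟨hdet0, ?_⟩
  have hadj : (φ.mapMatrix (stageMatrix a)).adjugate =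
      aeval w (stageDen a) • (w⁻¹ • N⁻¹) := by
    have h1 := Matrix.mul_adjugate (φ.mapMatrix (stageMatrix a))
    have h2 : (φ.mapMatrix (stageMatrix a)).det = aeval w (stageDen a) := by
      rw [← hφ, stageDen, RingHom.map_det]
    rw [h2, hM] at h1
    rw [hM]
    have h3 := congrArg (fun Z => (w⁻¹ • N⁻¹) * Z) h1
    simp only [← mul_assoc] at h3
    rw [Matrix.smul_mul, Matrix.mul_smul, smul_smul, Matrix.nonsing_inv_mul N hNdet,
      inv_mul_cancel₀ hw, one_smul, one_mul, Matrix.mul_smul, mul_one] at h3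
    exact h3
  have hadj' : ∀ i j, aeval w ((stageMatrix a).adjugate i j) =
      aeval w (stageDen a) * (w⁻¹ * N⁻¹ i j) := by
    intro i j
    have h1 := congrFun (congrFun (φ.map_adjugate (stageMatrix a)) i) j
    rw [hadj] at h1
    exact h1
  rw [stageNum, stabilityFunction, ← hN]
  simp only [map_add, map_mul, map_sum, map_sub, map_one, aeval_X, aeval_C, hadj',
    Complex.coe_algebraMap, dotProduct, Matrix.mulVec, mul_one]
  rw [mul_add, mul_one, Finset.mul_sum, Finset.mul_sum, Finset.mul_sum]
  congr 1
  refine Finset.sum_congr rfl fun j _ => ?_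
  simp only [← Finset.mul_sum]
  field_simp

/-- The disc is |w|² ≤ Re w, that is, Re w⁻¹ ≥ 1. -/
theorem re_one_sub_inv_nonpos {w : ℂ} (hw : w ≠ 0)
    (hmem : w ∈ Metric.closedBall (1 / 2 : ℂ) (1 / 2)) : (1 - w⁻¹).re ≤ 0 := by
  rw [mem_closedBall_iff_norm] at hmem
  have h1 := pow_le_pow_left₀ (norm_nonneg _) hmem 2
  rw [Complex.sq_norm, Complex.normSq_apply] at h1
  have hpos : 0 < Complex.normSq w := Complex.normSq_pos.2 hw
  have h2 : 1 ≤ w.re / Complex.normSq w := by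
    rw [one_le_div hpos, Complex.normSq_apply]
    norm_num at h1
    nlinarith
  simpa [Complex.inv_re] using h2

theorem stage_bounds (h₁ : CondRK1 a b) (h₂ : CondRK2 a) {w : ℂ} (hw : w ≠ 0)
    (hmem : w ∈ Metric.closedBall (1 / 2 : ℂ) (1 / 2)) :
    aeval w (stageDen a) ≠ 0 ∧ ‖aeval w (stageNum a b)‖ ≤ ‖aeval w (stageDen a)‖ := by
  have hz := re_one_sub_inv_nonpos hw hmem
  obtain ⟨hd, he⟩ := aeval_stage (b := b) w hw (h₂ _ hz)
  refine ⟨hd, ?_⟩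
  rw [he, norm_mul]
  exact mul_le_of_le_one_right (norm_nonneg _) (h₁ _ hz)

end StagePolynomials

/-! ### Polynomial inequalities on discs. -/

section PolynomialEstimates

open Polynomial

theorem ofReal_mem_closedBall_half {t : ℝ} (h0 : 0 ≤ t) (h1 : t ≤ 1) :
    (t : ℂ) ∈ Metric.closedBall (1 / 2 : ℂ) (1 / 2) := by
  rw [mem_closedBall_iff_norm, show (t : ℂ) - 1 / 2 = ((t - 1 / 2 : ℝ) : ℂ) by push_cast; ring,
    Complex.norm_real, Real.norm_eq_abs, abs_le]
  constructor <;> linarith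

theorem norm_aeval_zero_le_of_tendsto {p q : ℝ[X]}
    (h : ∀ t : ℝ, 0 < t → t ≤ 1 → ‖aeval (t : ℂ) p‖ ≤ ‖aeval (t : ℂ) q‖) :
    ‖aeval (0 : ℂ) p‖ ≤ ‖aeval (0 : ℂ) q‖ := by
  have hlim : ∀ p : ℝ[X], Tendsto (fun t : ℝ => ‖aeval (t : ℂ) p‖) (𝓝[>] 0)
      (𝓝 ‖aeval (0 : ℂ) p‖) := by
    intro p
    have hc : Continuous fun t : ℝ => ‖aeval (t : ℂ) p‖ :=
      (p.continuous_aeval.comp Complex.continuous_ofReal).norm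
    simpa using (hc.tendsto 0).mono_left nhdsWithin_le_nhds
  refine le_of_tendsto_of_tendsto (hlim p) (hlim q) ?_
  filter_upwards [Ioc_mem_nhdsGT zero_lt_one] with t ht
  exact h t ht.1 ht.2

/-- Cancelling common zeros at the boundary point `0` of the disc. -/
theorem exists_reduced_fraction {d e : ℝ[X]}
    (h : ∀ w : ℂ, w ≠ 0 → w ∈ Metric.closedBall (1 / 2 : ℂ) (1 / 2) →
      aeval w d ≠ 0 ∧ ‖aeval w e‖ ≤ ‖aeval w d‖) :
    ∃ (m : ℕ) (p q : ℝ[X]), d = X ^ m * q ∧ e = X ^ m * p ∧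
      ∀ w ∈ Metric.closedBall (1 / 2 : ℂ) (1 / 2), aeval w q ≠ 0 ∧ ‖aeval w p‖ ≤ ‖aeval w q‖ := by
  have hd0 : d ≠ 0 := by
    rintro rfl
    exact (h 1 one_ne_zero (by
      simpa using ofReal_mem_closedBall_half zero_le_one le_rfl)).1 (map_zero _)
  have hfac : ∀ f : ℝ[X], f ≠ 0 → ∃ (k : ℕ) (g : ℝ[X]), f = X ^ k * g ∧ aeval (0 : ℂ) g ≠ 0 := by
    intro f hf
    obtain ⟨g, hg, hnd⟩ := exists_eq_pow_rootMultiplicity_mul_and_not_dvd f hf 0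
    rw [C_0, sub_zero] at hg hnd
    refine ⟨_, g, hg, fun h0 => hnd ?_⟩
    rw [X_dvd_iff, coeff_zero_eq_eval_zero]
    have h1 : aeval ((algebraMap ℝ ℂ) 0) g = 0 := by simpa using h0
    rw [aeval_algebraMap_apply] at h1
    simpa using h1
  obtain ⟨m, q, hdq, hq0⟩ := hfac d hd0
  have hle : ∀ t : ℝ, 0 < t → t ≤ 1 → ‖aeval (t : ℂ) e‖ ≤ ‖aeval (t : ℂ) d‖ := fun t h0 h1 =>
    (h t (by exact_mod_cast h0.ne') (ofReal_mem_closedBall_half h0.le h1)).2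
  have hdvd : ∃ p, e = X ^ m * p := by
    by_cases he0 : e = 0
    · exact ⟨0, by rw [he0, mul_zero]⟩
    obtain ⟨k, e', hee', he'0⟩ := hfac e he0
    rcases le_or_gt m k with hmk | hkm
    · exact ⟨X ^ (k - m) * e', by rw [← mul_assoc, ← pow_add, Nat.add_sub_cancel' hmk, hee']⟩
    -- A zero of e at 0 of lower order than that of d would contradict |e| ≤ |d| along small
    -- positive reals.
    · exfalso
      have h1 : ‖aeval (0 : ℂ) e'‖ ≤ ‖aeval (0 : ℂ) (X ^ (m - k) * q)‖ := by
        refine norm_aeval_zero_le_of_tendsto fun t h0 h1 => ?_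
        have h2 := hle t h0 h1
        have h3 : d = X ^ k * (X ^ (m - k) * q) := by
          rw [← mul_assoc, ← pow_add, Nat.add_sub_cancel' hkm.le, hdq]
        rw [hee', h3, map_mul, map_mul (aeval (t : ℂ)) (X ^ k), norm_mul, norm_mul] at h2
        refine le_of_mul_le_mul_left h2 (norm_pos_iff.2 ?_)
        rw [map_pow, aeval_X]
        exact pow_ne_zero _ (by exact_mod_cast h0.ne')
      rw [map_mul, map_pow, aeval_X, zero_pow (by omega), zero_mul, norm_zero] at h1
      exact he'0 (norm_le_zero_iff.1 h1)
  obtain ⟨p, hep⟩ := hdvd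
  have hne : ∀ w : ℂ, w ≠ 0 → w ∈ Metric.closedBall (1 / 2 : ℂ) (1 / 2) →
      aeval w q ≠ 0 ∧ ‖aeval w p‖ ≤ ‖aeval w q‖ := by
    intro w hw hmem
    obtain ⟨h1, h2⟩ := h w hw hmem
    rw [hdq, map_mul] at h1
    rw [hdq, hep, map_mul, map_mul, norm_mul, norm_mul] at h2
    refine ⟨right_ne_zero_of_mul h1, le_of_mul_le_mul_left h2 (norm_pos_iff.2 ?_)⟩
    exact left_ne_zero_of_mul h1
  refine ⟨m, p, q, hdq, hep, fun w hmem => ?_⟩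
  by_cases hw : w = 0
  · subst hw
    refine ⟨hq0, norm_aeval_zero_le_of_tendsto fun t h0 h1 => ?_⟩
    exact (hne t (by exact_mod_cast h0.ne') (ofReal_mem_closedBall_half h0.le h1)).2
  · exact hne w hw hmem

theorem exists_lipschitz_aeval (p : ℝ[X]) (r : ℝ) : ∃ L : ℝ, 0 ≤ L ∧
    ∀ z ∈ Metric.closedBall (0 : ℂ) r, ∀ w ∈ Metric.closedBall (0 : ℂ) r,
      ‖aeval z p - aeval w p‖ ≤ L * ‖z - w‖ := by
  obtain ⟨L, hL⟩ := (isCompact_closedBall (0 : ℂ) r).exists_bound_of_continuousOn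
    (f := fun z => aeval z (derivative p)) (derivative p).continuous_aeval.continuousOn
  refine ⟨max L 0, le_max_right _ _, fun z hz w hw => ?_⟩
  refine (convex_closedBall (0 : ℂ) r).norm_image_sub_le_of_norm_hasDerivWithin_le
    (f := fun z => aeval z p) (f' := fun z => aeval z (derivative p))
    (fun x _ => (p.hasDerivAt_aeval x).hasDerivWithinAt)
    (fun x hx => (hL x hx).trans (le_max_left _ _)) hw hz

/-- Bounds on the disc `closedBall (1 / 2) (1 / 2)` persist on slightly larger discs. -/
theorem exists_bounds_on_larger_disc {p q : ℝ[X]}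
    (h : ∀ w ∈ Metric.closedBall (1 / 2 : ℂ) (1 / 2), aeval w q ≠ 0 ∧ ‖aeval w p‖ ≤ ‖aeval w q‖) :
    ∃ κ C δ : ℝ, 0 < κ ∧ 0 ≤ C ∧ 0 < δ ∧ ∀ c : ℝ, 1 / 2 ≤ c → c ≤ 1 / 2 + δ →
      ∀ z ∈ Metric.closedBall (c : ℂ) c, κ ≤ ‖aeval z q‖ ∧
        ‖aeval z p‖ ≤ (1 + C * (c - 1 / 2)) * ‖aeval z q‖ := by
  obtain ⟨w₀, hw₀, hmin⟩ := (isCompact_closedBall (1 / 2 : ℂ) (1 / 2)).exists_isMinOn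
    ⟨1 / 2, Metric.mem_closedBall_self (by norm_num)⟩
    (f := fun z => ‖aeval z q‖) q.continuous_aeval.norm.continuousOn
  set κ := ‖aeval w₀ q‖ with hκ
  have hκpos : 0 < κ := norm_pos_iff.2 (h w₀ hw₀).1
  obtain ⟨L₁, hL₁, hp⟩ := exists_lipschitz_aeval p 2
  obtain ⟨L₂, hL₂, hq⟩ := exists_lipschitz_aeval q 2
  -- Points move by at most 2(c - 1/2), so δ keeps the change of q below κ/2, and C absorbs both
  -- Lipschitz errors using |q| ≥ κ/2.
  refine ⟨κ / 2, 4 * (L₁ + L₂) / κ, min (1 / 2) (κ / (4 * (L₂ + 1))), by positivity,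
    by positivity, by positivity, fun c hc hcδ z hz => ?_⟩
  have hc1 : c ≤ 1 := by linarith [min_le_left (1 / 2) (κ / (4 * (L₂ + 1)))]
  have hc2 : c - 1 / 2 ≤ κ / (4 * (L₂ + 1)) := by
    linarith [min_le_right (1 / 2) (κ / (4 * (L₂ + 1)))]
  have hcpos : 0 < c := by linarith
  rw [mem_closedBall_iff_norm] at hz
  have hzn : ‖z‖ ≤ 2 * c := by
    have := norm_add_le (z - c) (c : ℂ)
    rw [sub_add_cancel, Complex.norm_real, Real.norm_of_nonneg hcpos.le] at this
    linarith
  -- Scaling by 1/(2c) maps the disc of centre and radius c onto the one of centre and radius 1/2.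
  set z' := (((2 * c)⁻¹ : ℝ) : ℂ) * z with hz'
  have hcc : (c : ℂ) ≠ 0 := by exact_mod_cast hcpos.ne'
  have hz'mem : z' ∈ Metric.closedBall (1 / 2 : ℂ) (1 / 2) := by
    rw [mem_closedBall_iff_norm]
    have h1 : z' - 1 / 2 = (((2 * c)⁻¹ : ℝ) : ℂ) * (z - c) := by
      rw [hz']
      push_cast
      field_simp
    rw [h1, norm_mul, Complex.norm_real, Real.norm_of_nonneg (by positivity),
      inv_mul_le_iff₀ (by positivity)]
    linarith
  have hzz' : ‖z - z'‖ ≤ 2 * (c - 1 / 2) := by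
    have h1 : z - z' = (((2 * c - 1) * (2 * c)⁻¹ : ℝ) : ℂ) * z := by
      rw [hz']
      push_cast
      field_simp
    have h2 : 0 ≤ 2 * c - 1 := by linarith
    rw [h1, norm_mul, Complex.norm_real, Real.norm_of_nonneg (by positivity), mul_assoc]
    have h3 : (2 * c)⁻¹ * ‖z‖ ≤ 1 := by
      rw [inv_mul_le_iff₀ (by positivity)]
      linarith
    nlinarith
  have hz2 : z ∈ Metric.closedBall (0 : ℂ) 2 := by
    rw [mem_closedBall_zero_iff]
    linarith
  have hz'2 : z' ∈ Metric.closedBall (0 : ℂ) 2 := by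
    rw [mem_closedBall_zero_iff]
    rw [mem_closedBall_iff_norm] at hz'mem
    have := norm_add_le (z' - 1 / 2) (1 / 2 : ℂ)
    rw [sub_add_cancel] at this
    norm_num at this hz'mem
    linarith
  have hp1 := (hp z hz2 z' hz'2).trans (mul_le_mul_of_nonneg_left hzz' hL₁)
  have hq1 := (hq z hz2 z' hz'2).trans (mul_le_mul_of_nonneg_left hzz' hL₂)
  have hq2 : κ ≤ ‖aeval z' q‖ := hmin hz'mem
  have hp2 := norm_le_norm_add_norm_sub' (aeval z p) (aeval z' p)
  have hq3 := norm_le_norm_add_norm_sub (aeval z q) (aeval z' q)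
  have hpq := (h z' hz'mem).2
  have hκ2 : κ / 2 ≤ ‖aeval z q‖ := by
    rw [le_div_iff₀ (by positivity)] at hc2
    nlinarith
  refine ⟨hκ2, ?_⟩
  have h5 : 2 * (L₁ + L₂) * (c - 1 / 2) ≤ 4 * (L₁ + L₂) / κ * (c - 1 / 2) * ‖aeval z q‖ := by
    have h6 : 2 * (L₁ + L₂) * (c - 1 / 2) =
        4 * (L₁ + L₂) / κ * (c - 1 / 2) * (κ / 2) := by
      field_simp
      ring
    rw [h6]
    refine mul_le_mul_of_nonneg_left hκ2 (mul_nonneg (by positivity) (by linarith))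
  linarith

end PolynomialEstimates

/-! ### The operator S(hA) as a fraction in the resolvent, and its bound. -/

section StabilityOperator

open Polynomial ContinuousLinearMap

variable {𝕜 : Type*} [RCLike 𝕜] {Y : Type*} [NormedAddCommGroup Y] [InnerProductSpace 𝕜 Y]

theorem commute_polyOp {F G : Y →L[𝕜] Y} (h : Commute F G) (p : ℝ[X]) :
    Commute F (polyOp G p) := by
  induction p using Polynomial.induction_on' with
  | add p q hp hq =>
    rw [map_add]
    exact hp.add_right hq
  | monomial n r =>
    rw [← C_mul_X_pow_eq_monomial, map_mul, map_pow, polyOp_X, polyOp_C]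
    exact ((Commute.one_right F).smul_right _).mul_right (h.pow_right n)

theorem isStarNormal_polyOp [CompleteSpace Y] {G : Y →L[𝕜] Y} (hG : IsStarNormal G) (p : ℝ[X]) :
    IsStarNormal (polyOp G p) := by
  refine ⟨?_⟩
  have h1 : Commute (star G) (polyOp G p) := commute_polyOp hG.star_comm_self p
  have h2 : Commute (star (polyOp G p)) G := by
    have := h1.star_star
    rw [star_star] at this
    exact this.symm
  exact commute_polyOp h2 p

/-- The lower bound makes F*F coercive, hence invertible; F and F* commute, so each factor is
invertible. -/
theorem isUnit_of_isStarNormal_of_le [CompleteSpace Y] {F : Y →L[𝕜] Y} (hF : IsStarNormal F)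
    {κ : ℝ} (hκ : 0 < κ) (h : ∀ x, κ * ‖x‖ ≤ ‖F x‖) : IsUnit F := by
  have h1 : IsUnit (star F * F) := by
    refine isUnit_of_forall_le_norm_inner_map _ (c := ⟨κ ^ 2, by positivity⟩)
      (by exact pow_pos hκ 2) fun x => ?_
    rw [star_eq_adjoint, mul_apply_eq_comp, adjoint_inner_left, inner_self_eq_norm_sq_to_K,
      norm_pow, RCLike.norm_ofReal, abs_of_nonneg (norm_nonneg _)]
    change ‖x‖ ^ 2 * κ ^ 2 ≤ _
    rw [mul_comm, ← mul_pow]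
    exact pow_le_pow_left₀ (by positivity) (h x) 2
  exact (hF.star_comm_self.isUnit_mul_iff.1 h1).2

theorem isUnit_of_norm_sub_lt [CompleteSpace Y] {F F' : Y →L[𝕜] Y} (hF : IsUnit F)
    {κ : ℝ} (hκ : 0 < κ) (h : ∀ x, κ * ‖x‖ ≤ ‖F x‖) (hlt : ‖F - F'‖ < κ) : IsUnit F' := by
  obtain ⟨u, rfl⟩ := hF
  have hinv : ‖((u⁻¹ : (Y →L[𝕜] Y)ˣ) : Y →L[𝕜] Y)‖ ≤ κ⁻¹ := by
    refine opNorm_le_bound _ (inv_nonneg.2 hκ.le) fun x => ?_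
    have h1 := h (((u⁻¹ : (Y →L[𝕜] Y)ˣ) : Y →L[𝕜] Y) x)
    rw [← mul_apply_eq_comp, u.mul_inv, one_apply_eq_self] at h1
    rwa [← div_eq_inv_mul, le_div_iff₀ hκ, mul_comm]
  have h2 : ‖((u⁻¹ : (Y →L[𝕜] Y)ˣ) : Y →L[𝕜] Y) * (u - F')‖ < 1 := by
    refine lt_of_le_of_lt ((norm_mul_le _ _).trans (mul_le_mul_of_nonneg_right hinv
      (norm_nonneg _))) ?_
    rwa [inv_mul_lt_iff₀ hκ, mul_one]
  have h3 : F' = (u : Y →L[𝕜] Y) *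
      (Units.oneSub (((u⁻¹ : (Y →L[𝕜] Y)ˣ) : Y →L[𝕜] Y) * (u - F')) h2 : (Y →L[𝕜] Y)ˣ) := by
    rw [Units.val_oneSub, mul_sub, ← mul_assoc, u.mul_inv]
    simp
  rw [h3]
  exact u.isUnit.mul (Units.isUnit _)

variable {s : ℕ} {a : Matrix (Fin s) (Fin s) ℝ} {b : Fin s → ℝ} {A : Y →ₗ.[𝕜] Y} {h : ℝ}
  {G : Y →L[𝕜] Y}

theorem sum_polyOp_stageMatrix (x : Fin s → Y) (i : Fin s) :
    ∑ j, polyOp G (stageMatrix a i j) (x j) =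
      G (x i) - ∑ j, (a i j : 𝕜) • (G (x j) - x j) := by
  have h1 : ∀ j, polyOp G (stageMatrix a i j) (x j) =
      (if i = j then G (x j) else 0) - (a i j : 𝕜) • (G (x j) - x j) := by
    intro j
    have h2 : stageMatrix a i j = (if i = j then X else 0) - C (a i j) * (X - 1) := by
      simp only [stageMatrix, Matrix.sub_apply, Matrix.smul_apply, Matrix.one_apply,
        Matrix.map_apply, smul_eq_mul, mul_ite, mul_one, mul_zero]
      ring
    rw [h2, map_sub, map_mul, polyOp_C, map_sub, polyOp_X, map_one]
    split_ifs
    · rw [polyOp_X]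
      rfl
    · rw [map_zero]
      rfl
  simp only [h1, Finset.sum_sub_distrib, Finset.sum_ite_eq, Finset.mem_univ, if_true]

/-- Substituting W = Gx gives hAW = Gx - x, which turns the unbounded stage equations into a bounded
system: the stage matrix evaluated at G. -/
theorem mem_stepGraph_iff (hG : IsScaledResolvent A h G) (hh : h ≠ 0) {U V : Y} :
    (U, V) ∈ stepGraph a b A h ↔ ∃ x : Fin s → Y,
      (∀ i, ∑ j, polyOp G (stageMatrix a i j) (x j) = U) ∧
        V = U + ∑ j, (b j : 𝕜) • (G (x j) - x j) := by
  have key : ∀ (c : Fin s → ℝ) (W : Fin s → A.domain) (x : Fin s → Y),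
      (∀ j, (W j : Y) = G (x j)) →
      (h : 𝕜) • ∑ j, (c j : 𝕜) • A (W j) = ∑ j, (c j : 𝕜) • (G (x j) - x j) := by
    intro c W x hWx
    rw [Finset.smul_sum]
    refine Finset.sum_congr rfl fun j _ => ?_
    rw [smul_comm, hG.apply_eq hh (W j) (hWx j)]
  simp only [sum_polyOp_stageMatrix]
  constructor
  · rintro ⟨W, hW, hV⟩
    have hex : ∀ j, ∃ u, G u = W j := fun j => by
      have : (W j : Y) ∈ Set.range G := by
        rw [hG.range_eq hh]
        exact (W j).2
      exact this
    choose x hx using hex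
    have hx' : ∀ j, (W j : Y) = G (x j) := fun j => (hx j).symm
    refine ⟨x, fun i => ?_, ?_⟩
    · rw [← key (a i) W x hx', hx i]
      exact hW i
    · rw [← key b W x hx']
      exact hV
  · rintro ⟨x, hx, hV⟩
    have hdom : ∀ j, G (x j) ∈ A.domain := fun j => by
      have : G (x j) ∈ Set.range G := ⟨x j, rfl⟩
      rwa [hG.range_eq hh] at this
    refine ⟨fun j => ⟨G (x j), hdom j⟩, fun i => ?_, ?_⟩
    · rw [key (a i) _ x fun j => rfl]
      exact hx i
    · rw [key b _ x fun j => rfl]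
      exact hV

theorem polyOp_stageNum_apply (y : Y) : polyOp G (stageNum a b) y = polyOp G (stageDen a) y +
    ∑ j, (b j : 𝕜) • (G (∑ i, polyOp G ((stageMatrix a).adjugate j i) y) -
      ∑ i, polyOp G ((stageMatrix a).adjugate j i) y) := by
  rw [stageNum, map_add, Finset.mul_sum, map_sum, _root_.add_apply, _root_.sum_apply]
  congr 1
  refine Finset.sum_congr rfl fun j _ => ?_
  rw [mul_left_comm, map_mul, polyOp_C, map_mul, map_sub, polyOp_X, map_one, map_sum]
  simp only [_root_.smul_apply, mul_apply_eq_comp, one_apply_eq_self, _root_.sub_apply,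
    smul_mul_assoc, one_mul, _root_.sum_apply]

/-- Cramer's rule: the adjugate applied to y solves the stage system with right-hand side det(y). -/
theorem mem_stepGraph_of_polyOp (hG : IsScaledResolvent A h G) (hh : h ≠ 0) (y : Y) :
    (polyOp G (stageDen a) y, polyOp G (stageNum a b) y) ∈ stepGraph a b A h := by
  rw [mem_stepGraph_iff hG hh]
  refine ⟨fun j => ∑ i, polyOp G ((stageMatrix a).adjugate j i) y, fun i => ?_,
    polyOp_stageNum_apply y⟩
  simp only [map_sum]
  rw [Finset.sum_comm]
  simp only [← mul_apply_eq_comp, ← map_mul, ← _root_.sum_apply, ← map_sum, ← Matrix.mul_apply]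
  rw [Matrix.mul_adjugate]
  simp only [Matrix.smul_apply, Matrix.one_apply, smul_eq_mul, mul_ite, mul_one, mul_zero,
    Finset.sum_ite_eq, Finset.mem_univ, if_true, stageDen]

/-- Multiplying the stage system by the adjugate expresses det applied to each stage through U. -/
theorem polyOp_eq_of_mem_stepGraph (hG : IsScaledResolvent A h G) (hh : h ≠ 0) {U V : Y}
    (hUV : (U, V) ∈ stepGraph a b A h) :
    polyOp G (stageDen a) V = polyOp G (stageNum a b) U := by
  obtain ⟨x, hx, rfl⟩ := (mem_stepGraph_iff hG hh).1 hUV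
  have hadj : ∀ k, ∑ i, polyOp G ((stageMatrix a).adjugate k i) U = polyOp G (stageDen a) (x k) := by
    intro k
    have h1 : ∀ i, polyOp G ((stageMatrix a).adjugate k i) U =
        ∑ j, polyOp G ((stageMatrix a).adjugate k i * stageMatrix a i j) (x j) := by
      intro i
      rw [← hx i, map_sum]
      simp only [map_mul, mul_apply_eq_comp]
    simp only [h1]
    rw [Finset.sum_comm]
    simp only [← _root_.sum_apply, ← map_sum, ← Matrix.mul_apply]
    rw [Matrix.adjugate_mul, Finset.sum_eq_single k]
    · simp [stageDen]
    · intro j _ hj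
      simp [Matrix.one_apply_ne hj.symm]
    · simp
  have hcomm : ∀ v, polyOp G (stageDen a) (G v) = G (polyOp G (stageDen a) v) := fun v =>
    (congrArg (fun F : Y →L[𝕜] Y => F v) (commute_polyOp (Commute.refl G) (stageDen a)).eq).symm
  rw [polyOp_stageNum_apply, map_add, map_sum]
  congr 1
  refine Finset.sum_congr rfl fun j _ => ?_
  rw [hadj, map_smul, map_sub, hcomm]

/-- Injectivity of Gᵐ cancels the common factor, so the step graph lies in the graph of p(G) q(G)⁻¹.
Conversely Gᵐ q(G) has dense range, so Cramer solutions fill that graph up to closure. -/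
theorem isStabilityOperator_of_fraction (hG : IsScaledResolvent A h G) (hh : h ≠ 0)
    (hA : Dense (A.domain : Set Y)) {m : ℕ} {p q : ℝ[X]} (hd : stageDen a = X ^ m * q)
    (he : stageNum a b = X ^ m * p) (u : (Y →L[𝕜] Y)ˣ) (hu : (u : Y →L[𝕜] Y) = polyOp G q) :
    IsStabilityOperator a b A h (polyOp G p * ((u⁻¹ : (Y →L[𝕜] Y)ˣ) : Y →L[𝕜] Y)) := by
  set S := polyOp G p * ((u⁻¹ : (Y →L[𝕜] Y)ˣ) : Y →L[𝕜] Y) with hS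
  have hpq : Commute (polyOp G p) (u : Y →L[𝕜] Y) := by
    rw [hu]
    exact commute_polyOp (commute_polyOp (Commute.refl G) p).symm q
  have hSu : ∀ y, S ((u : Y →L[𝕜] Y) y) = polyOp G p y := fun y => by
    rw [← mul_apply_eq_comp, hS, mul_assoc, u.inv_mul, mul_one]
  have huS : ∀ y, (u : Y →L[𝕜] Y) (S y) = polyOp G p y := fun y => by
    rw [← mul_apply_eq_comp, hS, ← mul_assoc, ← hpq.eq, mul_assoc, u.mul_inv, mul_one]
  have huinj : Function.Injective (u : Y →L[𝕜] Y) := fun x y hxy => by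
    have h1 := congrArg ((u⁻¹ : (Y →L[𝕜] Y)ˣ) : Y →L[𝕜] Y) hxy
    rwa [← mul_apply_eq_comp, ← mul_apply_eq_comp, u.inv_mul] at h1
  have husurj : Function.Surjective (u : Y →L[𝕜] Y) := fun x =>
    ⟨((u⁻¹ : (Y →L[𝕜] Y)ˣ) : Y →L[𝕜] Y) x, by
      rw [← mul_apply_eq_comp, u.mul_inv, one_apply_eq_self]⟩
  have hGm : ∀ (f : ℝ[X]) (y : Y), polyOp G (X ^ m * f) y = (G ^ m) (polyOp G f y) := fun f y => by
    rw [map_mul, map_pow, polyOp_X, mul_apply_eq_comp]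
  have hGinj : Function.Injective (G ^ m) := by
    rw [FunLike.coe_pow_eq_iterate]
    exact (hG.injective hh).iterate m
  have hGdense : ∀ n : ℕ, DenseRange (G ^ n) := by
    intro n
    induction n with
    | zero => exact Function.surjective_id.denseRange
    | succ n ih =>
      rw [pow_succ']
      exact (hG.denseRange hh hA).comp ih G.continuous
  apply Set.Subset.antisymm
  · refine closure_minimal ?_ (isClosed_eq continuous_snd (S.continuous.comp continuous_fst))
    rintro ⟨U, V⟩ hUV
    have h1 := polyOp_eq_of_mem_stepGraph hG hh hUV
    rw [hd, he, hGm, hGm, ← hu, ← huS] at h1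
    exact huinj (hGinj h1)
  · rintro ⟨x, y⟩ hxy
    have hxy : y = S x := hxy
    subst hxy
    have hdr : DenseRange fun y => polyOp G (stageDen a) y := by
      have h1 : (fun y => polyOp G (stageDen a) y) = (G ^ m) ∘ (u : Y →L[𝕜] Y) := by
        ext y
        rw [hd, hGm, hu]
        rfl
      rw [h1]
      exact (hGdense m).comp husurj.denseRange (G ^ m).continuous
    have hc : Continuous fun x => (x, S x) := by fun_prop
    have h2 : (x, S x) ∈ closure ((fun x => (x, S x)) '' Set.range
        fun y => polyOp G (stageDen a) y) :=
      image_closure_subset_closure_image hc ⟨x, hdr x, rfl⟩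
    refine closure_mono ?_ h2
    rintro _ ⟨_, ⟨y, rfl⟩, rfl⟩
    have h3 : S (polyOp G (stageDen a) y) = polyOp G (stageNum a b) y := by
      have h4 : stageDen a = q * X ^ m := by rw [hd, mul_comm]
      rw [h4, map_mul, ← hu, he, mul_comm, map_mul]
      exact hSu _
    simp only [h3]
    exact mem_stepGraph_of_polyOp hG hh y

theorem isStabilityOperator_zero (hA : Dense (A.domain : Set Y)) :
    IsStabilityOperator a b A 0 (1 : Y →L[𝕜] Y) := by
  apply Set.Subset.antisymm
  · refine closure_minimal ?_ (isClosed_eq continuous_snd (by fun_prop))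
    rintro ⟨U, V⟩ ⟨W, -, hV⟩
    simpa using hV
  · rintro ⟨x, y⟩ hxy
    have hxy : y = x := hxy
    subst hxy
    have hc : Continuous fun x : Y => (x, x) := by fun_prop
    have h2 : (y, y) ∈ closure ((fun x => (x, x)) '' (A.domain : Set Y)) :=
      image_closure_subset_closure_image hc ⟨y, hA y, rfl⟩
    refine closure_mono ?_ h2
    rintro _ ⟨U, hU, rfl⟩
    exact ⟨fun _ => ⟨U, hU⟩, by simp, by simp⟩

/-- Real-variable form of the comparison of the step operator with its normal counterpart. -/
theorem norm_le_of_perturbed {P P' Q Q' x κ ε η : ℝ} (hκ : 0 < κ) (hε : 0 ≤ ε) (hη : 0 ≤ η)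
    (h₁ : P ≤ P' + ε * x) (h₂ : P' ≤ (1 + η) * Q') (h₃ : Q' ≤ Q + ε * x)
    (h₄ : κ * x ≤ Q) : P ≤ (1 + (η + (2 + η) * ε / κ)) * Q := by
  have h5 : x ≤ Q / κ := by rwa [le_div_iff₀ hκ, mul_comm]
  have h6 : (2 + η) * ε * x ≤ (2 + η) * ε * (Q / κ) := mul_le_mul_of_nonneg_left h5 (by positivity)
  have h7 : (1 + η) * Q' ≤ (1 + η) * (Q + ε * x) := mul_le_mul_of_nonneg_left h₃ (by positivity)
  calc P ≤ (1 + η) * Q + (2 + η) * ε * x := by linarith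
    _ ≤ (1 + η) * Q + (2 + η) * ε * (Q / κ) := by linarith
    _ = _ := by ring

theorem opNorm_pow_le_exp {S : Y →L[𝕜] Y} {r : ℝ} (hS : ‖S‖ ≤ Real.exp r) (n : ℕ) :
    ‖S ^ n‖ ≤ Real.exp (n * r) := by
  rw [Real.exp_nat_mul]
  induction n with
  | zero =>
    rw [pow_zero, pow_zero]
    exact norm_id_le
  | succ n ih =>
    rw [pow_succ, pow_succ]
    exact (norm_mul_le _ _).trans (mul_le_mul ih hS (norm_nonneg _) (by positivity))

/-- The stability operator of an A-stable method and a bounded perturbation of a normal generator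
satisfies `‖S(hA)‖ ≤ e^{ω h}`. -/
theorem exists_stabilityOperator [CompleteSpace Y] (h₁ : CondRK1 a b) (h₂ : CondRK2 a)
    {T : ℝ → Y →L[𝕜] Y} (hT : IsC0Semigroup T) {N : Y →ₗ.[𝕜] Y} (B : Y →L[𝕜] Y)
    (hA : IsGenerator (N + (B : Y →ₗ[𝕜] Y).toPMap ⊤) T) (hN : IsNormalOperator N)
    (hdense : Dense ((N + (B : Y →ₗ[𝕜] Y).toPMap ⊤).domain : Set Y)) :
    ∃ ω h₀ : ℝ, 0 < ω ∧ 0 < h₀ ∧ ∀ h, 0 < h → h ≤ h₀ → ∃ S : Y →L[𝕜] Y,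
      IsStabilityOperator a b (N + (B : Y →ₗ[𝕜] Y).toPMap ⊤) h S ∧ ‖S‖ ≤ Real.exp (ω * h) := by
  obtain ⟨ω, C₁, h₀, hω, hC₁, hh₀, hest⟩ := exists_resolvent_estimates hT B hA hN
  obtain ⟨m, p, q, hd, he, hpq⟩ := exists_reduced_fraction
    (d := stageDen a) (e := stageNum a b) fun w hw hmem => stage_bounds h₁ h₂ hw hmem
  obtain ⟨κ, C₂, δ, hκ, hC₂, hδ, hdisc⟩ := exists_bounds_on_larger_disc hpq
  obtain ⟨Lp, hLp, hlipp⟩ := norm_polyOp_le_and_lipschitz (𝕜 := 𝕜) (Y := Y) p C₁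
  obtain ⟨Lq, hLq, hlipq⟩ := norm_polyOp_le_and_lipschitz (𝕜 := 𝕜) (Y := Y) q C₁
  set E := (Lp + Lq) * C₁ with hE
  have hE0 : 0 ≤ E := by positivity
  set W := C₂ * ω + (2 + C₂ * ω) * E / (κ / 2) with hW
  have hW0 : 0 ≤ W := by positivity
  -- The bounds on h give, in turn: the resolvent estimates, control of the h² term, c - 1/2 ≤ δ,
  -- and Eh ≤ κ/2. Adding 1 to W makes the rate positive.
  refine ⟨W + 1, min h₀ (min 1 (min (δ / (ω + 1)) (κ / (2 * (E + 1))))), by positivity,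
    by positivity, fun h hh hle => ?_⟩
  simp only [le_min_iff] at hle
  obtain ⟨hle₀, hle1, hleδ, hleκ⟩ := hle
  rw [le_div_iff₀ (by positivity)] at hleδ hleκ
  obtain ⟨hhω, G, G', hG, hnormal, hGC, hGC', hGG', hball⟩ := hest h hh hle₀
  set c := (2 * (1 - h * ω))⁻¹ with hc
  have hhω0 : 0 ≤ h * ω := by positivity
  have hcpos : 0 < 2 * (1 - h * ω) := by linarith
  have hc1 : 1 / 2 ≤ c := by
    rw [hc, le_inv_comm₀ (by norm_num) hcpos]
    norm_num
    linarith
  have hc2 : c ≤ 1 / 2 + h * ω := by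
    rw [hc, inv_le_iff_one_le_mul₀ hcpos]
    nlinarith
  have hcd := hdisc c hc1 (by nlinarith)
  have hqne : ∀ z ∈ Metric.closedBall (c : ℂ) c, aeval z q ≠ 0 := fun z hz =>
    norm_pos_iff.1 (hκ.trans_le (hcd z hz).1)
  have hqG' : ∀ x, κ * ‖x‖ ≤ ‖polyOp G' q x‖ := by
    intro x
    -- Comparing the constant polynomial κ with q gives a lower bound for q(G').
    have h3 := norm_polyOp_le_of_isStarNormal hnormal zero_le_one hball (p := C κ) hqne
      (fun z hz => by
        rw [aeval_C, one_mul, Complex.coe_algebraMap, Complex.norm_real,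
          Real.norm_of_nonneg hκ.le]
        exact (hcd z hz).1) x
    rwa [polyOp_C, _root_.smul_apply, one_apply_eq_self, norm_smul, RCLike.norm_ofReal,
      abs_of_pos hκ, one_mul] at h3
  have hpG' : ∀ x, ‖polyOp G' p x‖ ≤ (1 + C₂ * ω * h) * ‖polyOp G' q x‖ := by
    intro x
    refine norm_polyOp_le_of_isStarNormal hnormal (by positivity) hball hqne
      (fun z hz => (hcd z hz).2.trans (mul_le_mul_of_nonneg_right ?_ (norm_nonneg _))) x
    have : C₂ * (c - 1 / 2) ≤ C₂ * (h * ω) := mul_le_mul_of_nonneg_left (by linarith) hC₂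
    linarith
  have hlip : ∀ (f : ℝ[X]) (L : ℝ), 0 ≤ L → L ≤ Lp + Lq →
      ‖polyOp G f - polyOp G' f‖ ≤ L * ‖G - G'‖ → ‖polyOp G f - polyOp G' f‖ ≤ E * h := by
    intro f L hL hLE hf
    calc _ ≤ L * ‖G - G'‖ := hf
      _ ≤ (Lp + Lq) * (C₁ * h) := mul_le_mul hLE hGG' (norm_nonneg _) (by positivity)
      _ = E * h := by rw [hE]; ring
  have hdp := hlip p Lp hLp (by linarith) (hlipp G G' hGC hGC').2
  have hdq := hlip q Lq hLq (by linarith) (hlipq G G' hGC hGC').2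
  have hEh : E * h ≤ κ / 2 := by nlinarith
  have hdpx : ∀ x, ‖polyOp G p x‖ ≤ ‖polyOp G' p x‖ + E * h * ‖x‖ := fun x => by
    have h3 := norm_le_norm_add_norm_sub' (polyOp G p x) (polyOp G' p x)
    have h4 := le_of_opNorm_le _ hdp x
    rw [_root_.sub_apply] at h4
    linarith
  have hdqx : ∀ x, ‖polyOp G' q x‖ ≤ ‖polyOp G q x‖ + E * h * ‖x‖ := fun x => by
    have h3 := norm_le_norm_add_norm_sub (polyOp G q x) (polyOp G' q x)
    have h4 := le_of_opNorm_le _ hdq x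
    rw [_root_.sub_apply] at h4
    linarith
  have hqG : ∀ x, κ / 2 * ‖x‖ ≤ ‖polyOp G q x‖ := fun x => by
    have h3 := mul_le_mul_of_nonneg_right hEh (norm_nonneg x)
    linarith [hqG' x, hdqx x]
  obtain ⟨u, hu⟩ := isUnit_of_norm_sub_lt
    (isUnit_of_isStarNormal_of_le (isStarNormal_polyOp hnormal q) hκ hqG') hκ hqG'
    (F' := polyOp G q) (by
      rw [norm_sub_rev]
      linarith)
  refine ⟨_, isStabilityOperator_of_fraction hG hh.ne' hdense hd he u hu, ?_⟩
  have hbound : ∀ x, ‖polyOp G p x‖ ≤ (1 + W * h) * ‖polyOp G q x‖ := by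
    intro x
    refine (norm_le_of_perturbed (half_pos hκ) (by positivity) (by positivity) (hdpx x) (hpG' x)
      (hdqx x) (hqG x)).trans (mul_le_mul_of_nonneg_right ?_ (norm_nonneg _))
    have h3 : (2 + C₂ * ω * h) * (E * h) ≤ (2 + C₂ * ω) * (E * h) := by
      refine mul_le_mul_of_nonneg_right ?_ (by positivity)
      have : C₂ * ω * h ≤ C₂ * ω := mul_le_of_le_one_right (by positivity) hle1
      linarith
    have h4 := div_le_div_of_nonneg_right h3 (half_pos hκ).le
    have h5 : W * h = C₂ * ω * h + (2 + C₂ * ω) * (E * h) / (κ / 2) := by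
      rw [hW]
      ring
    linarith
  have hn : ‖polyOp G p * ((u⁻¹ : (Y →L[𝕜] Y)ˣ) : Y →L[𝕜] Y)‖ ≤ 1 + W * h := by
    refine opNorm_le_bound _ (by positivity) fun x => ?_
    have h3 := hbound (((u⁻¹ : (Y →L[𝕜] Y)ˣ) : Y →L[𝕜] Y) x)
    rwa [← hu, ← mul_apply_eq_comp, ← mul_apply_eq_comp, u.mul_inv, one_apply_eq_self] at h3
  have h6 := Real.add_one_le_exp ((W + 1) * h)
  linarith

end StabilityOperator

end RKStab

theorem lemmal {𝕜 : Type*} [RCLike 𝕜] {Y : Type*} [NormedAddCommGroup Y]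
    [InnerProductSpace 𝕜 Y] [CompleteSpace Y] {s : ℕ}
    (a : Matrix (Fin s) (Fin s) ℝ) (b : Fin s → ℝ)
    (hRK1 : RKStab.CondRK1 a b) (hRK2 : RKStab.CondRK2 a)
    (A : Y →ₗ.[𝕜] Y) (K : ℕ) (hA2 : RKStab.CondA2 A K) :
    ∃ ωS : ℝ, 0 < ωS ∧ ∃ hstar : ℝ, 0 < hstar ∧ ∀ h : ℝ, 0 ≤ h → h ≤ hstar →
      ∃ S : Y →L[𝕜] Y, RKStab.IsStabilityOperator a b A h S ∧
        ∀ n : ℕ, ‖S ^ n‖ ≤ Real.exp (ωS * n * h) := by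
  obtain ⟨⟨-, hdense, T, hT, hgen⟩, N, B₀, hAeq, hN, hB⟩ := hA2
  -- Level k = 0 of the scale is Y with its own norm, so this is ordinary boundedness.
  obtain ⟨C, hC⟩ := hB 0 (Nat.zero_le K)
  have hscale : ∀ x, RKStab.scaleNorm A 0 x = ‖x‖ := fun x =>
    (norm_eq_sqrt_re_inner (𝕜 := 𝕜) x).symm
  let B : Y →L[𝕜] Y := B₀.mkContinuous C fun x => by
    have h := (hC x trivial).2
    rwa [hscale, hscale] at h
  have hAB : A = N + (B : Y →ₗ[𝕜] Y).toPMap ⊤ := hAeq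
  clear_value B
  subst hAB
  obtain ⟨ω, h₀, hω, hh₀, hS⟩ :=
    RKStab.exists_stabilityOperator (b := b) hRK1 hRK2 hT B hgen hN hdense
  refine ⟨ω, hω, h₀, hh₀, fun h h0 hle => ?_⟩
  -- The resolvent parametrisation divides by h, so h = 0 is separate: there S is the identity,
  -- extended from D(A) by density.
  rcases h0.eq_or_lt with rfl | hpos
  · refine ⟨1, RKStab.isStabilityOperator_zero hdense, fun n => ?_⟩
    rw [one_pow, mul_zero, Real.exp_zero]
    exact ContinuousLinearMap.norm_id_le
  · obtain ⟨S, hSop, hSn⟩ := hS h hpos hle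
    refine ⟨S, hSop, fun n => (RKStab.opNorm_pow_le_exp hSn n).trans (le_of_eq ?_)⟩
    congr 1
    ring

end
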